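/- Let $K$ be a field, and let $E$ and $F$ be finite directed graphs (finitely many vertices and finitely many edges; loops and parallel edges are allowed) with no sinks, i.e. every vertex emits at least one edge. Let $A_E$ be the adjacency matrix of $E$, whose $(u,v)$ entry is the number of edges from $u$ to $v$, and let $A_F$ be that of $F$. Let $\mathcal L(E)=\mathcal L_K(E)$ be the Leavitt path algebra of $E$: the $K$-algebra generated by the vertices $v$, the edges $\alpha$ and the ghost edges $\alpha^*$ (with $s(\alpha)$, $r(\alpha)$ the source and range of $\alpha$) subject to 1. $vw=\delta_{v,w}v$ for all vertices $v,w$; 2. $s(\alpha)\alpha=\alpha r(\alpha)=\alpha$ and $r(\alpha)\alpha^*=\alpha^*s(\alpha)=\alpha^*$ for all edges $\alpha$; 3. $\alpha^*\beta=\delta_{\alpha,\beta}\,r(\alpha)$ for all edges $\alpha,\beta$; 4. $\sum_{s(\alpha)=v}\alpha\alpha^*=v$ for every vertex $v$ that emits an edge. Its identity element is the sum of all vertices, and it is $\mathbb Z$-graded by $\deg v=0$, $\deg\alpha=1$, $\deg\alpha^*=-1$. For a $\mathbb Z$-graded ring $A$, let $K_0^{\operatorname{gr}}(A)$ be the group completion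 of the commutative monoid $\mathcal V^{\operatorname{gr}}(A)$ of graded isomorphism classes $[P]$ of graded finitely generated projective right $A$-modules under direct sum. It is a $\mathbb Z[x,x^{-1}]$-module via $x^n[P]=[P(n)]$, where $P(n)_i=P_{i+n}$, and it is pre-ordered with positive cone the image of $\mathcal V^{\operatorname{gr}}(A)$. Nonnegative integer square matrices $A$ and $B$ are shift equivalent if there are an integer $l\ge 1$ and nonnegative integer matrices $R$, $S$ with $A^l=RS$, $B^l=SR$, $AR=RB$ and $SA=BS$. **Corollary 5.2.** The matrices $A_E$ and $A_F$ are shift equivalent if and only if there is an isomorphism of $\mathbb Z[x,x^{-1}]$-modules $\varphi:K_0^{\operatorname{gr}}(\mathcal L(E))\to K_0^{\operatorname{gr}}(\mathcal L(F))$ such that, for all $a,b$, $a\le b$ if and only if $\varphi(a)\le\varphi(b)$ (equivalently, $\varphi$ maps the positive cone onto the positive cone). -/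

import Mathlib

open scoped LaurentPolynomial DirectSum

universe u v w

/-! ### Directed graphs

A directed graph is a `Quiver`: a type `V` of vertices together with a type `a ⟶ b` of edges from
`a` to `b` for all vertices `a`, `b`, so that parallel edges and loops are allowed.  The set of all
edges is `Quiver.Total V`; the source of `e : Quiver.Total V` is `e.left` and its range is
`e.right`.  A graph is finite if `V` and all the types `a ⟶ b` are finite. -/

/-- A graph has no sinks if every vertex emits an edge. -/
def Quiver.NoSinks (V : Type u) [Quiver.{v} V] : Prop :=
  ∀ a : V, ∃ b : V, Nonempty (a ⟶ b)

/-- The adjacency matrix: the entry at `(a, b)` is the number of edges from `a` to `b`. -/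
def Quiver.adjacency (V : Type u) [Quiver.{v} V] [∀ a b : V, Fintype (a ⟶ b)] : Matrix V V ℕ :=
  Matrix.of fun a b => Fintype.card (a ⟶ b)

/-- Shift equivalence (with some lag `l ≥ 1`) of square nonnegative integer matrices. -/
def Matrix.ShiftEquivalent {m : Type*} {n : Type*} [Fintype m] [DecidableEq m] [Fintype n]
    [DecidableEq n] (A : Matrix m m ℕ) (B : Matrix n n ℕ) : Prop :=
  ∃ l : ℕ, 1 ≤ l ∧ ∃ (R : Matrix m n ℕ) (S : Matrix n m ℕ),
    A ^ l = R * S ∧ B ^ l = S * R ∧ A * R = R * B ∧ S * A = B * S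

/-! ### The Leavitt path algebra of a finite graph -/

/-- The generators of the Leavitt path algebra: vertices, edges and ghost edges. -/
inductive LeavittGen (V : Type u) [Quiver.{v} V] : Type (max u v)
  | vertex (a : V) : LeavittGen V
  | edge (e : Quiver.Total V) : LeavittGen V
  | ghost (e : Quiver.Total V) : LeavittGen V

namespace LeavittGen

/-- The standard degrees: `0` for vertices, `1` for edges, `-1` for ghost edges. -/
def degree {V : Type u} [Quiver.{v} V] : LeavittGen V → ℤ
  | vertex _ => 0
  | edge _ => 1
  | ghost _ => -1

end LeavittGen

section Leavitt

variable (K : Type w) [CommRing K] (V : Type u) [Quiver.{v} V] [Fintype V]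
  [∀ a b : V, Fintype (a ⟶ b)]

/-- The defining relations of the Leavitt path algebra.  As the graph is finite, the algebra
generated by vertices, edges and ghost edges has the sum of all vertices as its identity element;
since we present it as a quotient of the free *unital* algebra, this is the last relation. -/
inductive LeavittRel : FreeAlgebra K (LeavittGen V) → FreeAlgebra K (LeavittGen V) → Prop
  | vertex_mul_self (a : V) :
      LeavittRel (FreeAlgebra.ι K (.vertex a) * FreeAlgebra.ι K (.vertex a))
        (FreeAlgebra.ι K (.vertex a))
  | vertex_mul_of_ne (a b : V) (h : a ≠ b) :
      LeavittRel (FreeAlgebra.ι K (.vertex a) * FreeAlgebra.ι K (.vertex b)) 0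
  | source_mul_edge (e : Quiver.Total V) :
      LeavittRel (FreeAlgebra.ι K (.vertex e.left) * FreeAlgebra.ι K (.edge e))
        (FreeAlgebra.ι K (.edge e))
  | edge_mul_range (e : Quiver.Total V) :
      LeavittRel (FreeAlgebra.ι K (.edge e) * FreeAlgebra.ι K (.vertex e.right))
        (FreeAlgebra.ι K (.edge e))
  | range_mul_ghost (e : Quiver.Total V) :
      LeavittRel (FreeAlgebra.ι K (.vertex e.right) * FreeAlgebra.ι K (.ghost e))
        (FreeAlgebra.ι K (.ghost e))
  | ghost_mul_source (e : Quiver.Total V) :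
      LeavittRel (FreeAlgebra.ι K (.ghost e) * FreeAlgebra.ι K (.vertex e.left))
        (FreeAlgebra.ι K (.ghost e))
  | ghost_mul_edge_self (e : Quiver.Total V) :
      LeavittRel (FreeAlgebra.ι K (.ghost e) * FreeAlgebra.ι K (.edge e))
        (FreeAlgebra.ι K (.vertex e.right))
  | ghost_mul_edge_of_ne (e f : Quiver.Total V) (h : e ≠ f) :
      LeavittRel (FreeAlgebra.ι K (.ghost e) * FreeAlgebra.ι K (.edge f)) 0
  | sum_edge_mul_ghost (a : V) (h : ∃ b : V, Nonempty (a ⟶ b)) :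
      LeavittRel
        (∑ b : V, ∑ α : a ⟶ b,
          FreeAlgebra.ι K (.edge ⟨a, b, α⟩) * FreeAlgebra.ι K (.ghost ⟨a, b, α⟩))
        (FreeAlgebra.ι K (.vertex a))
  | sum_vertex : LeavittRel (∑ a : V, FreeAlgebra.ι K (.vertex a)) 1

/-- The Leavitt path algebra `L_K(E)` of a finite graph `E` with vertex set `V`. -/
abbrev LeavittPathAlgebra : Type (max u v w) := RingQuot (LeavittRel K V)

namespace LeavittPathAlgebra

/-- The image of a generator in the Leavitt path algebra. -/
noncomputable def gen (g : LeavittGen V) : LeavittPathAlgebra K V :=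
  RingQuot.mkAlgHom K (LeavittRel K V) (FreeAlgebra.ι K g)

/-- The standard `ℤ`-grading of the Leavitt path algebra, induced from the free algebra: the
component of degree `k` is spanned by the products of generators of total degree `k`. -/
def grading (k : ℤ) : Submodule K (LeavittPathAlgebra K V) :=
  Submodule.span K
    {x | ∃ l : List (LeavittGen V), (l.map LeavittGen.degree).sum = k ∧ (l.map (gen K V)).prod = x}

theorem gen_mem_grading (g : LeavittGen V) : gen K V g ∈ grading K V g.degree :=
  Submodule.subset_span ⟨[g], by simp, by simp⟩

instance grading_gradedMonoid : SetLike.GradedMonoid (grading K V) where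
  one_mem := Submodule.subset_span ⟨[], by simp, by simp⟩
  mul_mem := by
    intro i j x y hx hy
    have h := Submodule.mul_mem_mul hx hy
    rw [grading, grading, Submodule.span_mul_span] at h
    refine Submodule.span_mono ?_ h
    rintro _ ⟨_, ⟨l, rfl, rfl⟩, _, ⟨l', rfl, rfl⟩, rfl⟩
    exact ⟨l ++ l', by simp, by simp⟩

theorem of_eq_of {i j : ℤ} (x : grading K V i) (y : grading K V j) (hij : i = j)
    (hxy : (x : LeavittPathAlgebra K V) = y) :
    DirectSum.of (fun i => grading K V i) i x = DirectSum.of (fun i => grading K V i) j y := by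
  subst hij
  rw [Subtype.ext hxy]

/-- A generator, as an element of the direct sum of the homogeneous components. -/
noncomputable def decomposeGen (g : LeavittGen V) : ⨁ i, grading K V i :=
  DirectSum.of (fun i => grading K V i) g.degree ⟨gen K V g, gen_mem_grading K V g⟩

theorem mk_eq_of_rel {x y : FreeAlgebra K (LeavittGen V)} (h : LeavittRel K V x y) :
    RingQuot.mkAlgHom K (LeavittRel K V) x = RingQuot.mkAlgHom K (LeavittRel K V) y :=
  RingQuot.mkAlgHom_rel K h

theorem decompose_rel {x y : FreeAlgebra K (LeavittGen V)} (h : LeavittRel K V x y) :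
    FreeAlgebra.lift K (decomposeGen K V) x = FreeAlgebra.lift K (decomposeGen K V) y := by
  have hm := mk_eq_of_rel K V h
  have hmul : ∀ g g' g'' : LeavittGen V, g.degree + g'.degree = g''.degree →
      gen K V g * gen K V g' = gen K V g'' →
      decomposeGen K V g * decomposeGen K V g' = decomposeGen K V g'' := by
    intro g g' g'' hd hg
    rw [decomposeGen, decomposeGen, DirectSum.of_mul_of]
    exact of_eq_of K V _ _ hd hg
  have hmul' : ∀ (g g' : LeavittGen V) (x : LeavittPathAlgebra K V),
      g.degree + g'.degree = 0 → ∀ hx : x ∈ grading K V 0, gen K V g * gen K V g' = x →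
      decomposeGen K V g * decomposeGen K V g' =
        DirectSum.of (fun i => grading K V i) 0 ⟨x, hx⟩ := by
    intro g g' x hd hx hg
    rw [decomposeGen, decomposeGen, DirectSum.of_mul_of]
    exact of_eq_of K V _ _ hd hg
  have hzero : ∀ g g' : LeavittGen V, gen K V g * gen K V g' = 0 →
      decomposeGen K V g * decomposeGen K V g' = 0 := by
    intro g g' hg
    rw [decomposeGen, decomposeGen, DirectSum.of_mul_of,
      ← map_zero (DirectSum.of (fun i => grading K V i) (g.degree + g'.degree))]
    exact of_eq_of K V _ _ rfl hg
  cases h with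
  | vertex_mul_self a =>
    simp only [map_mul, FreeAlgebra.lift_ι_apply] at hm ⊢
    exact hmul _ _ _ rfl hm
  | vertex_mul_of_ne a b h =>
    simp only [map_mul, map_zero, FreeAlgebra.lift_ι_apply] at hm ⊢
    exact hzero _ _ hm
  | source_mul_edge e =>
    simp only [map_mul, FreeAlgebra.lift_ι_apply] at hm ⊢
    exact hmul _ _ _ rfl hm
  | edge_mul_range e =>
    simp only [map_mul, FreeAlgebra.lift_ι_apply] at hm ⊢
    exact hmul _ _ _ rfl hm
  | range_mul_ghost e =>
    simp only [map_mul, FreeAlgebra.lift_ι_apply] at hm ⊢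
    exact hmul _ _ _ rfl hm
  | ghost_mul_source e =>
    simp only [map_mul, FreeAlgebra.lift_ι_apply] at hm ⊢
    exact hmul _ _ _ rfl hm
  | ghost_mul_edge_self e =>
    simp only [map_mul, FreeAlgebra.lift_ι_apply] at hm ⊢
    exact hmul _ _ _ rfl hm
  | ghost_mul_edge_of_ne e f h =>
    simp only [map_mul, map_zero, FreeAlgebra.lift_ι_apply] at hm ⊢
    exact hzero _ _ hm
  | sum_edge_mul_ghost a h =>
    simp only [map_sum, map_mul, FreeAlgebra.lift_ι_apply] at hm ⊢
    have h0 : ∀ (b : V) (α : a ⟶ b),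
        gen K V (.edge ⟨a, b, α⟩) * gen K V (.ghost ⟨a, b, α⟩) ∈ grading K V 0 := fun b α =>
      Submodule.subset_span ⟨[.edge ⟨a, b, α⟩, .ghost ⟨a, b, α⟩], by simp [LeavittGen.degree],
        by simp⟩
    have h1 : ∀ (b : V) (α : a ⟶ b),
        decomposeGen K V (.edge ⟨a, b, α⟩) * decomposeGen K V (.ghost ⟨a, b, α⟩) =
          DirectSum.of (fun i => grading K V i) 0 ⟨_, h0 b α⟩ :=
      fun b α => hmul' _ _ _ rfl (h0 b α) rfl
    simp only [h1, ← map_sum]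
    refine of_eq_of K V _ _ rfl ?_
    simp only [AddSubmonoidClass.coe_finsetSum]
    exact hm
  | sum_vertex =>
    simp only [map_sum, map_one, FreeAlgebra.lift_ι_apply] at hm ⊢
    have h1 : ∀ a : V, decomposeGen K V (.vertex a) =
        DirectSum.of (fun i => grading K V i) 0
          ⟨gen K V (.vertex a), gen_mem_grading K V (.vertex a)⟩ := fun a => rfl
    simp only [h1, ← map_sum, DirectSum.one_def]
    refine of_eq_of K V _ _ rfl ?_
    simp only [AddSubmonoidClass.coe_finsetSum]
    exact hm

/-- The decomposition of an element into its homogeneous components. -/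
noncomputable def decomposeHom : LeavittPathAlgebra K V →ₐ[K] ⨁ i, grading K V i :=
  RingQuot.liftAlgHom K ⟨FreeAlgebra.lift K (decomposeGen K V), fun _ _ h => decompose_rel K V h⟩

theorem decomposeHom_gen (g : LeavittGen V) : decomposeHom K V (gen K V g) = decomposeGen K V g := by
  rw [decomposeHom, gen, RingQuot.liftAlgHom_mkAlgHom_apply, FreeAlgebra.lift_ι_apply]

theorem decomposeHom_prod (l : List (LeavittGen V))
    (h : (l.map (gen K V)).prod ∈ grading K V (l.map LeavittGen.degree).sum) :
    decomposeHom K V (l.map (gen K V)).prod =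
      DirectSum.of (fun i => grading K V i) (l.map LeavittGen.degree).sum
        ⟨(l.map (gen K V)).prod, h⟩ := by
  induction l with
  | nil =>
    simp only [List.map_nil, List.prod_nil, map_one, DirectSum.one_def]
    exact of_eq_of K V _ _ rfl rfl
  | cons g l ih =>
    have h' : (l.map (gen K V)).prod ∈ grading K V (l.map LeavittGen.degree).sum :=
      Submodule.subset_span ⟨l, rfl, rfl⟩
    simp only [List.map_cons, List.prod_cons, map_mul]
    rw [ih h', decomposeHom_gen, decomposeGen, DirectSum.of_mul_of]
    exact of_eq_of K V _ _ (by simp) rfl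

/-- The Leavitt path algebra is a `ℤ`-graded algebra. -/
noncomputable instance grading_gradedAlgebra : GradedAlgebra (grading K V) :=
  GradedAlgebra.ofAlgHom (grading K V) (decomposeHom K V)
    (by
      refine RingQuot.ringQuot_ext' K _ _ (FreeAlgebra.hom_ext (funext fun g => ?_))
      change DirectSum.coeAlgHom (grading K V) (decomposeHom K V (gen K V g)) = gen K V g
      rw [decomposeHom_gen, decomposeGen, DirectSum.coeAlgHom_of])
    (by
      rintro i ⟨x, hx⟩
      change decomposeHom K V x = _
      induction hx using Submodule.span_induction with
      | mem x h =>
        obtain ⟨l, rfl, rfl⟩ := h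
        exact decomposeHom_prod K V l _
      | zero =>
        rw [map_zero]
        exact (map_zero _).symm
      | add x y hx hy ihx ihy =>
        rw [map_add, ihx, ihy, ← map_add]
        rfl
      | smul c x hx ih =>
        rw [map_smul, ih]
        exact (DirectSum.of_smul K (M := fun i => grading K V i) i c ⟨x, hx⟩).symm)

end LeavittPathAlgebra

end Leavitt

/-! ### Graded finitely generated projective modules and the graded Grothendieck group -/

section GradedK

/-- A family of subgroups is an internal direct sum decomposition if and only if it is independent
and spans. -/
theorem addSubgroup_isInternal_iff {G : Type u} [AddCommGroup G] (D : ℤ → AddSubgroup G) :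
    DirectSum.IsInternal D ↔ iSupIndep D ∧ iSup D = ⊤ := by
  have h : DirectSum.IsInternal D ↔
      DirectSum.IsInternal fun i => AddSubgroup.toIntSubmodule (D i) := Iff.rfl
  rw [h, DirectSum.isInternal_submodule_iff_iSupIndep_and_iSup_eq_top]
  refine and_congr (iSupIndep_map_orderIso_iff (AddSubgroup.toIntSubmodule (M := G))) ?_
  rw [← map_iSup (AddSubgroup.toIntSubmodule (M := G)), ← map_top (AddSubgroup.toIntSubmodule (M := G))]
  exact (AddSubgroup.toIntSubmodule (M := G)).injective.eq_iff

variable {σ : Type*} {A : Type u} [Ring A] [SetLike σ A] [AddSubgroupClass σ A]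

/-- A graded finitely generated projective right module over a `ℤ`-graded ring `A` with homogeneous
components `𝒜 i`.  Right `A`-modules are modules over `Aᵐᵒᵖ`, that is, `m a` is
`MulOpposite.op a • m`. -/
structure GradedProj (𝒜 : ℤ → σ) [GradedRing 𝒜] : Type (u + 1) where
  carrier : Type u
  [addCommGroup : AddCommGroup carrier]
  [module : Module Aᵐᵒᵖ carrier]
  component : ℤ → AddSubgroup carrier
  isInternal : DirectSum.IsInternal component
  smul_mem : ∀ {i j : ℤ} {a : A} {m : carrier}, m ∈ component i → a ∈ 𝒜 j →
    MulOpposite.op a • m ∈ component (i + j)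
  finite : Module.Finite Aᵐᵒᵖ carrier
  projective : Module.Projective Aᵐᵒᵖ carrier

attribute [instance] GradedProj.addCommGroup GradedProj.module GradedProj.finite
  GradedProj.projective

namespace GradedProj

variable {𝒜 : ℤ → σ} [GradedRing 𝒜]

/-- Graded isomorphism: an isomorphism of right modules which matches the components. -/
def Iso (P Q : GradedProj 𝒜) : Prop :=
  ∃ e : P.carrier ≃ₗ[Aᵐᵒᵖ] Q.carrier, ∀ (i : ℤ) (m : P.carrier),
    m ∈ P.component i ↔ e m ∈ Q.component i

variable (𝒜) in
/-- Graded modules up to graded isomorphism. -/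
instance setoid : Setoid (GradedProj 𝒜) where
  r := Iso
  iseqv :=
    { refl := fun P => ⟨LinearEquiv.refl _ _, fun _ _ => Iff.rfl⟩
      symm := by
        rintro P Q ⟨e, he⟩
        exact ⟨e.symm, fun i m => by rw [he, e.apply_symm_apply]⟩
      trans := by
        rintro P Q R ⟨e, he⟩ ⟨f, hf⟩
        exact ⟨e.trans f, fun i m => (he i m).trans (hf i (e m))⟩ }

variable (𝒜) in
/-- The zero module. -/
def zero : GradedProj 𝒜 where
  carrier := PUnit.{u + 1}
  component := fun _ => ⊤
  isInternal := by
    rw [addSubgroup_isInternal_iff]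
    refine ⟨fun i => ?_, Subsingleton.elim _ _⟩
    rw [disjoint_iff]
    exact Subsingleton.elim _ _
  smul_mem := fun _ _ => trivial
  finite := inferInstance
  projective := inferInstance

/-- The direct sum of two graded modules. -/
def add (P Q : GradedProj 𝒜) : GradedProj 𝒜 where
  carrier := P.carrier × Q.carrier
  component := fun i => (P.component i).prod (Q.component i)
  isInternal := by
    have hP := P.isInternal
    have hQ := Q.isInternal
    have h1 : ∀ x : ⨁ i, ((P.component i).prod (Q.component i)),
        DirectSum.coeAddMonoidHom (fun i => (P.component i).prod (Q.component i)) x =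
        (DirectSum.coeAddMonoidHom P.component (DirectSum.map (fun i =>
            ((AddMonoidHom.fst P.carrier Q.carrier).comp
              ((P.component i).prod (Q.component i)).subtype).codRestrict (P.component i)
              fun y => y.2.1) x),
          DirectSum.coeAddMonoidHom Q.component (DirectSum.map (fun i =>
            ((AddMonoidHom.snd P.carrier Q.carrier).comp
              ((P.component i).prod (Q.component i)).subtype).codRestrict (Q.component i)
              fun y => y.2.2) x)) := by
      intro x
      induction x using DirectSum.induction_on with
      | zero => simp only [map_zero]; rfl
      | of i x =>
        simp only [DirectSum.coeAddMonoidHom_of, DirectSum.map_of]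
        rfl
      | add x y hx hy =>
        rw [map_add, hx, hy]
        simp only [map_add, Prod.mk_add_mk]
    constructor
    · rw [injective_iff_map_eq_zero]
      intro x hx
      rw [h1, Prod.mk_eq_zero] at hx
      have hx1 := (injective_iff_map_eq_zero _).1 hP.1 _ hx.1
      have hx2 := (injective_iff_map_eq_zero _).1 hQ.1 _ hx.2
      refine DFinsupp.ext fun i => Subtype.ext (Prod.ext ?_ ?_)
      · exact congrArg Subtype.val (DFunLike.congr_fun hx1 i)
      · exact congrArg Subtype.val (DFunLike.congr_fun hx2 i)
    · rintro ⟨p, q⟩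
      obtain ⟨x, rfl⟩ := hP.2 p
      obtain ⟨y, rfl⟩ := hQ.2 q
      refine ⟨DirectSum.map (fun i =>
          ((AddMonoidHom.inl P.carrier Q.carrier).comp (P.component i).subtype).codRestrict
            ((P.component i).prod (Q.component i)) fun y => ⟨y.2, zero_mem _⟩) x +
        DirectSum.map (fun i =>
          ((AddMonoidHom.inr P.carrier Q.carrier).comp (Q.component i).subtype).codRestrict
            ((P.component i).prod (Q.component i)) fun y => ⟨zero_mem _, y.2⟩) y, ?_⟩
      have h2 : ∀ x, DirectSum.coeAddMonoidHom (fun i => (P.component i).prod (Q.component i))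
          (DirectSum.map (fun i =>
          ((AddMonoidHom.inl P.carrier Q.carrier).comp (P.component i).subtype).codRestrict
            ((P.component i).prod (Q.component i)) fun y => ⟨y.2, zero_mem _⟩) x) =
          (DirectSum.coeAddMonoidHom P.component x, 0) := by
        intro x
        induction x using DirectSum.induction_on with
        | zero => simp only [map_zero]; rfl
        | of i x =>
          simp only [DirectSum.coeAddMonoidHom_of, DirectSum.map_of]
          rfl
        | add x y hx hy => simp only [map_add, hx, hy, Prod.mk_add_mk, add_zero]
      have h3 : ∀ x, DirectSum.coeAddMonoidHom (fun i => (P.component i).prod (Q.component i))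
          (DirectSum.map (fun i =>
          ((AddMonoidHom.inr P.carrier Q.carrier).comp (Q.component i).subtype).codRestrict
            ((P.component i).prod (Q.component i)) fun y => ⟨zero_mem _, y.2⟩) x) =
          (0, DirectSum.coeAddMonoidHom Q.component x) := by
        intro x
        induction x using DirectSum.induction_on with
        | zero => simp only [map_zero]; rfl
        | of i x =>
          simp only [DirectSum.coeAddMonoidHom_of, DirectSum.map_of]
          rfl
        | add x y hx hy => simp only [map_add, hx, hy, Prod.mk_add_mk, add_zero]
      rw [map_add, h2, h3, Prod.mk_add_mk, add_zero, zero_add]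
  smul_mem := fun hm ha => ⟨P.smul_mem hm.1 ha, Q.smul_mem hm.2 ha⟩
  finite := inferInstance
  projective := inferInstance

/-- The shifted module `P(n)`, with `P(n)_i = P_{i + n}`. -/
def shift (n : ℤ) (P : GradedProj 𝒜) : GradedProj 𝒜 where
  carrier := P.carrier
  component := fun i => P.component (i + n)
  isInternal := by
    have h := (addSubgroup_isInternal_iff _).1 P.isInternal
    rw [addSubgroup_isInternal_iff]
    refine ⟨h.1.comp (add_left_injective n), ?_⟩
    rw [← h.2]
    exact (Equiv.addRight n).iSup_comp (g := P.component)
  smul_mem := by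
    intro i j a m hm ha
    have h := P.smul_mem hm ha
    rwa [add_right_comm] at h
  finite := P.finite
  projective := P.projective

end GradedProj

/-- The monoid `𝒱^gr(A)` of graded isomorphism classes of graded finitely generated projective
right `A`-modules. -/
def GradedV (𝒜 : ℤ → σ) [GradedRing 𝒜] : Type (u + 1) := Quotient (GradedProj.setoid 𝒜)

namespace GradedV

variable (𝒜 : ℤ → σ) [GradedRing 𝒜]

variable {𝒜} in
/-- The class `[P]`. -/
def mk (P : GradedProj 𝒜) : GradedV 𝒜 := Quotient.mk _ P

instance : Zero (GradedV 𝒜) := ⟨mk (GradedProj.zero 𝒜)⟩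

/-- Addition is induced by direct sums: `[P] + [Q] = [P ⊕ Q]`. -/
instance : Add (GradedV 𝒜) where
  add := Quotient.map₂ GradedProj.add (by
    rintro P P' ⟨e, he⟩ Q Q' ⟨f, hf⟩
    exact ⟨e.prodCongr f, fun i m => and_congr (he i m.1) (hf i m.2)⟩)

instance : AddCommMonoid (GradedV 𝒜) where
  add_assoc := by
    rintro ⟨P⟩ ⟨Q⟩ ⟨R⟩
    exact Quotient.sound ⟨LinearEquiv.prodAssoc _ _ _ _, fun i m => and_assoc⟩
  zero_add := by
    rintro ⟨P⟩
    refine Quotient.sound ⟨LinearEquiv.uniqueProd (R := Aᵐᵒᵖ) (M := P.carrier) (M₂ := PUnit.{u + 1}),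
      fun i m => ?_⟩
    exact and_iff_right trivial
  add_zero := by
    rintro ⟨P⟩
    refine Quotient.sound ⟨LinearEquiv.prodUnique (R := Aᵐᵒᵖ) (M := P.carrier) (M₂ := PUnit.{u + 1}),
      fun i m => ?_⟩
    exact and_iff_left trivial
  add_comm := by
    rintro ⟨P⟩ ⟨Q⟩
    exact Quotient.sound ⟨LinearEquiv.prodComm _ _ _, fun i m => and_comm⟩
  nsmul := nsmulRec

/-- The action of `n : ℤ` on the monoid: `[P] ↦ [P(n)]`. -/
def shift (n : ℤ) : GradedV 𝒜 →+ GradedV 𝒜 where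
  toFun := Quotient.map (GradedProj.shift n) (by
    rintro P P' ⟨e, he⟩
    exact ⟨e, fun i m => he (i + n) m⟩)
  map_zero' := Quotient.sound ⟨LinearEquiv.refl _ _, fun _ _ => Iff.rfl⟩
  map_add' := by
    rintro ⟨P⟩ ⟨Q⟩
    exact Quotient.sound ⟨LinearEquiv.refl _ _, fun _ _ => Iff.rfl⟩

theorem shift_zero : shift 𝒜 0 = AddMonoidHom.id _ := by
  ext x
  induction x using Quotient.inductionOn with | _ P
  refine Quotient.sound ⟨LinearEquiv.refl _ _, fun i m => ?_⟩
  change m ∈ P.component (i + 0) ↔ m ∈ P.component i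
  rw [add_zero]

theorem shift_add (n k : ℤ) : shift 𝒜 (n + k) = (shift 𝒜 n).comp (shift 𝒜 k) := by
  ext x
  induction x using Quotient.inductionOn with | _ P
  refine Quotient.sound ⟨LinearEquiv.refl _ _, fun i m => ?_⟩
  change m ∈ P.component (i + (n + k)) ↔ m ∈ P.component (i + n + k)
  rw [add_assoc]

end GradedV

/-- The graded Grothendieck group `K₀^gr(A)`: the group completion of `𝒱^gr(A)`. -/
def GradedK0 (𝒜 : ℤ → σ) [GradedRing 𝒜] : Type (u + 1) :=
  Algebra.GrothendieckAddGroup (GradedV 𝒜)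

namespace GradedK0

variable (𝒜 : ℤ → σ) [GradedRing 𝒜]

noncomputable instance : AddCommGroup (GradedK0 𝒜) :=
  inferInstanceAs (AddCommGroup (Algebra.GrothendieckAddGroup (GradedV 𝒜)))

/-- The canonical map `𝒱^gr(A) → K₀^gr(A)`. -/
def of : GradedV 𝒜 →+ GradedK0 𝒜 := Algebra.GrothendieckAddGroup.of

/-- Homomorphisms out of the graded Grothendieck group are determined on classes of modules. -/
theorem hom_ext {G : Type*} [AddCommGroup G] {f g : GradedK0 𝒜 →+ G}
    (h : f.comp (of 𝒜) = g.comp (of 𝒜)) : f = g :=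
  (Algebra.GrothendieckAddGroup.lift (M := GradedV 𝒜) (G := G)).symm.injective h

/-- The endomorphism of `K₀^gr(A)` induced by `[P] ↦ [P(n)]`. -/
noncomputable def shift (n : ℤ) : AddMonoid.End (GradedK0 𝒜) :=
  Algebra.GrothendieckAddGroup.lift (M := GradedV 𝒜) (G := GradedK0 𝒜)
    ((of 𝒜).comp (GradedV.shift 𝒜 n))

theorem shift_comp_of (n : ℤ) :
    AddMonoidHom.comp (shift 𝒜 n) (of 𝒜) = (of 𝒜).comp (GradedV.shift 𝒜 n) :=
  (Algebra.GrothendieckAddGroup.lift (M := GradedV 𝒜) (G := GradedK0 𝒜)).symm_apply_apply _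

theorem shift_of (n : ℤ) (x : GradedV 𝒜) : shift 𝒜 n (of 𝒜 x) = of 𝒜 (GradedV.shift 𝒜 n x) :=
  DFunLike.congr_fun (shift_comp_of 𝒜 n) x

/-- The action of the group `ℤ` on `K₀^gr(A)` by shifts. -/
noncomputable def shiftHom : Multiplicative ℤ →* AddMonoid.End (GradedK0 𝒜) where
  toFun n := shift 𝒜 n.toAdd
  map_one' := by
    refine hom_ext 𝒜 (AddMonoidHom.ext fun x => ?_)
    change shift 𝒜 0 (of 𝒜 x) = of 𝒜 x
    rw [shift_of, GradedV.shift_zero]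
    rfl
  map_mul' n k := by
    refine hom_ext 𝒜 (AddMonoidHom.ext fun x => ?_)
    change shift 𝒜 (n.toAdd + k.toAdd) (of 𝒜 x) = shift 𝒜 n.toAdd (shift 𝒜 k.toAdd (of 𝒜 x))
    rw [shift_of, shift_of, shift_of, GradedV.shift_add]
    rfl

/-- The `ℤ[x, x⁻¹]`-module structure on `K₀^gr(A)`, with `xⁿ [P] = [P(n)]`. -/
noncomputable instance : Module ℤ[T;T⁻¹] (GradedK0 𝒜) :=
  Module.compHom (GradedK0 𝒜)
    (AddMonoidAlgebra.lift ℤ (AddMonoid.End (GradedK0 𝒜)) ℤ (shiftHom 𝒜)).toRingHom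

theorem T_smul_of_mk (n : ℤ) (P : GradedProj 𝒜) :
    (LaurentPolynomial.T n : ℤ[T;T⁻¹]) • of 𝒜 (GradedV.mk P) = of 𝒜 (GradedV.mk (P.shift n)) := by
  change AddMonoidAlgebra.lift ℤ (AddMonoid.End (GradedK0 𝒜)) ℤ (shiftHom 𝒜)
    (AddMonoidAlgebra.single n 1) (of 𝒜 (GradedV.mk P)) = _
  rw [AddMonoidAlgebra.lift_single, one_smul]
  exact shift_of 𝒜 n _

/-- The positive cone of `K₀^gr(A)`: the classes of graded finitely generated projective modules. -/
noncomputable def positiveCone : AddSubmonoid (GradedK0 𝒜) := AddMonoidHom.mrange (of 𝒜)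

/-- The preorder on `K₀^gr(A)` given by the positive cone. -/
noncomputable instance : Preorder (GradedK0 𝒜) where
  le x y := y - x ∈ positiveCone 𝒜
  le_refl x := by rw [sub_self]; exact zero_mem _
  le_trans x y z hxy hyz := by
    have h := add_mem hyz hxy
    rwa [sub_add_sub_cancel] at h

theorem le_iff (x y : GradedK0 𝒜) : x ≤ y ↔ y - x ∈ positiveCone 𝒜 := Iff.rfl

end GradedK0

end GradedK

/-! Both sides concern the direct limit of `ℤ^V` under right multiplication by the adjacency matrix
`A`, with `x` acting as `A`. `Matrix.IsDimensionModule` characterises this ordered module without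
constructing a limit: `x pᵥ = ∑ A v w p_w`, the cone consists of the elements `x⁻ⁿ ∑ aᵥ pᵥ` with
natural coefficients, and two vectors have the same image only if some power of `A` identifies them.
The matrices of a shift equivalence of lag `l` induce maps whose two composites are `x^l`, hence an
ordered isomorphism. Conversely, an ordered isomorphism sends the finitely many generators into the
cone, so it and its inverse are given, up to powers of `x`, by nonnegative matrices. The required
matrix identities hold in the limit, and hence hold exactly after multiplication by a high power
(`Matrix.IsDimensionModule.shiftEquivalent_iff`).

It remains to see that `K₀^gr` has this form, with `pᵥ` the class of `v L`
(`GradedK0.isDimensionModule`). Without sinks, `v = ∑ p p*` over the paths `p` of length `k` from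
`v`, so a homogeneous dual basis of a projective module can be pushed along paths into a single
degree and then refined at will. Along long paths an element `y` of degree zero has scalar entries:
each `p* y q` is a scalar multiple of a vertex (`exists_ghostPath_mul_mul_path`). Linear algebra
over `K` then extracts a basis, so each graded projective is, up to shift, a sum of vertex modules,
recorded by a vector in `ℕ^V`. Refinement along paths of length `k` multiplies the vector by `A ^
k`. Two vectors of one module in one degree agree after refinement, since they then count dimensions
of the same `K`-spaces. This count needs scalar multiples of vertices to be nonzero, which an
explicit representation shows (`smul_vtx_eq_zero`). -/

section DimensionModule

/-! ### Dimension modules of nonnegative integer matrices -/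

open Matrix LaurentPolynomial

/-- Natural number combinations of a family, as a linear map. -/
noncomputable abbrev natComb {V G : Type*} [Fintype V] [AddCommGroup G] (p : V → G) :
    (V → ℕ) →ₗ[ℕ] G :=
  Fintype.linearCombination ℕ p

theorem natComb_vecMul {V W G : Type*} [Fintype V] [Fintype W] [AddCommGroup G] (q : W → G)
    (a : V → ℕ) (M : Matrix V W ℕ) :
    natComb q (a ᵥ* M) = natComb (fun v => natComb q (M v)) a := by
  simp only [natComb, Fintype.linearCombination_apply, vecMul, dotProduct, Finset.sum_smul,
    Finset.smul_sum, mul_smul]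
  exact Finset.sum_comm

theorem LaurentPolynomial.T_smul_T_smul {G : Type*} [AddCommGroup G] [Module ℤ[T;T⁻¹] G]
    (m n : ℤ) (x : G) : (T m : ℤ[T;T⁻¹]) • (T n : ℤ[T;T⁻¹]) • x = (T (m + n) : ℤ[T;T⁻¹]) • x := by
  rw [smul_smul, ← T_add]

theorem LaurentPolynomial.T_smul_injective {G : Type*} [AddCommGroup G] [Module ℤ[T;T⁻¹] G]
    (n : ℤ) {x y : G} (h : (T n : ℤ[T;T⁻¹]) • x = (T n : ℤ[T;T⁻¹]) • y) : x = y := by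
  have := congrArg (fun z => (T (-n) : ℤ[T;T⁻¹]) • z) h
  simpa [T_smul_T_smul] using this

theorem LaurentPolynomial.smul_natComb {V G : Type*} [Fintype V] [AddCommGroup G]
    [Module ℤ[T;T⁻¹] G] (r : ℤ[T;T⁻¹]) (p : V → G) (a : V → ℕ) :
    r • natComb p a = natComb (fun v => r • p v) a := by
  simp only [Fintype.linearCombination_apply, Finset.smul_sum, smul_comm r]

theorem LinearMap.map_natComb {V G H : Type*} [Fintype V] [AddCommGroup G] [AddCommGroup H]
    [Module ℤ[T;T⁻¹] G] [Module ℤ[T;T⁻¹] H] (φ : G →ₗ[ℤ[T;T⁻¹]] H) (p : V → G) (a : V → ℕ) :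
    φ (natComb p a) = natComb (fun v => φ (p v)) a := by
  simp only [Fintype.linearCombination_apply, map_sum, map_nsmul]

/-- The family `p` satisfies the relations `x pᵥ = ∑ A v w p_w`. -/
def Matrix.Intertwines {V G : Type*} [Fintype V] [AddCommGroup G] [Module ℤ[T;T⁻¹] G]
    (A : Matrix V V ℕ) (p : V → G) : Prop :=
  ∀ v, (T 1 : ℤ[T;T⁻¹]) • p v = natComb p (A v)

section Intertwines

variable {V G : Type*} [Fintype V] [DecidableEq V] [AddCommGroup G] [Module ℤ[T;T⁻¹] G]
  {A : Matrix V V ℕ} {p : V → G}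

theorem Matrix.Intertwines.T_smul_natComb (h : A.Intertwines p) (k : ℕ) (a : V → ℕ) :
    (T (k : ℤ) : ℤ[T;T⁻¹]) • natComb p a = natComb p (a ᵥ* A ^ k) := by
  induction k generalizing a with
  | zero => simp
  | succ k ih =>
    rw [pow_succ', ← vecMul_vecMul, ← ih, natComb_vecMul]
    rw [Nat.cast_succ, ← T_smul_T_smul, smul_natComb (T 1)]
    simp only [h _]

/-- Negative powers of `x` are cleared by a large shift, and nonnegative powers are absorbed into
the coefficient vectors as powers of `A`. -/
theorem Matrix.Intertwines.exists_of_mem_span (h : A.Intertwines p) {x : G}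
    (hx : x ∈ Submodule.span ℤ[T;T⁻¹] (Set.range p)) :
    ∃ (n : ℕ) (a b : V → ℕ), (T (n : ℤ) : ℤ[T;T⁻¹]) • x = natComb p a - natComb p b := by
  have hadd : ∀ x y : G,
      (∃ (n : ℕ) (a b : V → ℕ), (T (n : ℤ) : ℤ[T;T⁻¹]) • x = natComb p a - natComb p b) →
      (∃ (n : ℕ) (a b : V → ℕ), (T (n : ℤ) : ℤ[T;T⁻¹]) • y = natComb p a - natComb p b) →
      ∃ (n : ℕ) (a b : V → ℕ),
        (T (n : ℤ) : ℤ[T;T⁻¹]) • (x + y) = natComb p a - natComb p b := by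
    rintro x y ⟨n, a, b, hx⟩ ⟨m, c, d, hy⟩
    -- Each pair of vectors is advanced by the exponent of the other one to reach the common shift
    -- `m + n`.
    refine ⟨m + n, a ᵥ* A ^ m + c ᵥ* A ^ n, b ᵥ* A ^ m + d ᵥ* A ^ n, ?_⟩
    rw [smul_add, Nat.cast_add, ← T_smul_T_smul, hx, add_comm (m : ℤ), ← T_smul_T_smul, hy,
      map_add, map_add, smul_sub, smul_sub]
    simp only [h.T_smul_natComb]
    abel
  induction hx using Submodule.span_induction with
  | mem x hx =>
    obtain ⟨v, rfl⟩ := hx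
    refine ⟨0, Pi.single v 1, 0, ?_⟩
    simp [natComb]
  | zero => exact ⟨0, 0, 0, by simp⟩
  | add x y _ _ hx hy => exact hadd x y hx hy
  | smul r x _ hx =>
    have hT : ∀ (j : ℤ) (y : G),
        (∃ (n : ℕ) (a b : V → ℕ), (T (n : ℤ) : ℤ[T;T⁻¹]) • y = natComb p a - natComb p b) →
        ∃ (n : ℕ) (a b : V → ℕ),
          (T (n : ℤ) : ℤ[T;T⁻¹]) • ((T j : ℤ[T;T⁻¹]) • y) = natComb p a - natComb p b := by
      rintro j y ⟨n, a, b, hy⟩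
      -- The negative part of `j` enlarges the shift and its positive part becomes a power of `A`.
      refine ⟨n + (-j).toNat, a ᵥ* A ^ j.toNat, b ᵥ* A ^ j.toNat, ?_⟩
      rw [← h.T_smul_natComb, ← h.T_smul_natComb, ← smul_sub, ← hy, T_smul_T_smul, T_smul_T_smul]
      congr 2
      push_cast
      omega
    have hz : ∀ z : ℤ,
        ∃ (n : ℕ) (a b : V → ℕ),
          (T (n : ℤ) : ℤ[T;T⁻¹]) • (z • x) = natComb p a - natComb p b := by
      intro z
      obtain ⟨n, a, b, hx⟩ := hx
      -- Writing `z` as the difference of its positive and negative parts, the negative part swaps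
      -- `a` and `b`, so coefficients stay natural.
      refine ⟨n, z.toNat • a + (-z).toNat • b, z.toNat • b + (-z).toNat • a, ?_⟩
      rw [smul_comm, hx]
      nth_rewrite 1 [← Int.toNat_sub_toNat_neg z]
      simp only [map_add, map_smul, sub_smul, natCast_zsmul, smul_sub]
      abel
    induction r using LaurentPolynomial.induction_on' with
    | add r s hr hs => rw [add_smul]; exact hadd _ _ hr hs
    | C_mul_T j z =>
      rw [mul_smul, smul_comm]
      refine hT j _ ?_
      have : (C z : ℤ[T;T⁻¹]) • x = z • x := by
        rw [← Int.cast_smul_eq_zsmul ℤ[T;T⁻¹]]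
        simp
      rw [this]
      exact hz z

end Intertwines

/-- `G`, with the positive cone `C` and the family `p`, is the dimension module of `A`, that is, the
direct limit of `ℤ^V` under iterated right multiplication by `A`. -/
structure Matrix.IsDimensionModule {V G : Type*} [Fintype V] [DecidableEq V] [AddCommGroup G]
    [Module ℤ[T;T⁻¹] G] (A : Matrix V V ℕ) (C : AddSubmonoid G) (p : V → G) : Prop where
  intertwines : A.Intertwines p
  mem_cone : ∀ x, x ∈ C ↔
    ∃ (n : ℕ) (a : V → ℕ), x = (T (-n : ℤ) : ℤ[T;T⁻¹]) • natComb p a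
  exists_sub : ∀ x, ∃ y ∈ C, ∃ z ∈ C, x = y - z
  eq_of_natComb_eq : ∀ a b : V → ℕ, natComb p a = natComb p b → ∃ k : ℕ, a ᵥ* A ^ k = b ᵥ* A ^ k

namespace Matrix.IsDimensionModule

variable {V G W H U : Type*} [Fintype V] [DecidableEq V] [AddCommGroup G] [Module ℤ[T;T⁻¹] G]
  {A : Matrix V V ℕ} {C : AddSubmonoid G} {p : V → G}
  [Fintype W] [DecidableEq W] [AddCommGroup H] [Module ℤ[T;T⁻¹] H]
  {B : Matrix W W ℕ} {D : AddSubmonoid H} {q : W → H}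

theorem natComb_mem (h : A.IsDimensionModule C p) (n : ℤ) (a : V → ℕ) :
    (T n : ℤ[T;T⁻¹]) • natComb p a ∈ C := by
  rw [h.mem_cone]
  refine ⟨(-n).toNat, a ᵥ* A ^ n.toNat, ?_⟩
  rw [← h.intertwines.T_smul_natComb, T_smul_T_smul]
  congr 2
  omega

theorem span_range (h : A.IsDimensionModule C p) :
    Submodule.span ℤ[T;T⁻¹] (Set.range p) = ⊤ := by
  have hC : ∀ y ∈ C, y ∈ Submodule.span ℤ[T;T⁻¹] (Set.range p) := by
    intro y hy
    obtain ⟨n, a, rfl⟩ := (h.mem_cone y).1 hy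
    refine Submodule.smul_mem _ _ ?_
    rw [Fintype.linearCombination_apply]
    exact Submodule.sum_mem _ fun v _ =>
      nsmul_mem (Submodule.subset_span (Set.mem_range_self v)) _
  rw [eq_top_iff]
  rintro x -
  obtain ⟨y, hy, z, hz, rfl⟩ := h.exists_sub x
  exact Submodule.sub_mem _ (hC y hy) (hC z hz)

/-- The universal property of the dimension module. -/
theorem exists_linearMap (h : A.IsDimensionModule C p) {q : V → H} (hq : A.Intertwines q) :
    ∃ φ : G →ₗ[ℤ[T;T⁻¹]] H, ∀ v, φ (p v) = q v := by
  -- The pairs satisfy the same relations, so denominators can be cleared in both coordinates at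
  -- once; this shows that every relation among the `p v` also holds among the `q v`.
  have hr : A.Intertwines fun v => (p v, q v) := by
    intro v
    simp only [natComb, Fintype.linearCombination_apply]
    rw [Prod.smul_mk, h.intertwines, hq]
    simp [Fintype.linearCombination_apply, Prod.ext_iff, Prod.fst_sum, Prod.snd_sum]
  let π := Fintype.linearCombination ℤ[T;T⁻¹] p
  have hsurj : LinearMap.range π = ⊤ := by
    rw [Fintype.range_linearCombination, h.span_range]
  have hker : LinearMap.ker π ≤ LinearMap.ker (Fintype.linearCombination ℤ[T;T⁻¹] q) := by
    intro f hf
    rw [LinearMap.mem_ker] at hf ⊢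
    have hmem : (π f, Fintype.linearCombination ℤ[T;T⁻¹] q f) ∈
        Submodule.span ℤ[T;T⁻¹] (Set.range fun v => (p v, q v)) := by
      rw [← Fintype.range_linearCombination]
      refine ⟨f, ?_⟩
      simp [π, Fintype.linearCombination_apply, Prod.ext_iff, Prod.fst_sum, Prod.snd_sum]
    obtain ⟨n, a, b, hab⟩ := hr.exists_of_mem_span hmem
    have h1 := congrArg (LinearMap.fst ℤ[T;T⁻¹] G H) hab
    have h2 := congrArg (LinearMap.snd ℤ[T;T⁻¹] G H) hab
    rw [map_sub, LinearMap.map_natComb, LinearMap.map_natComb] at h1 h2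
    simp only [map_smul, LinearMap.fst_apply, LinearMap.snd_apply, hf, smul_zero] at h1 h2
    -- The first coordinate vanishes, so a power of `A` identifies `a` and `b`; as `x ^ k` acts
    -- injectively, the second coordinate vanishes too.
    obtain ⟨k, hk⟩ := h.eq_of_natComb_eq a b (sub_eq_zero.1 h1.symm)
    have h3 : natComb q a = natComb q b := by
      refine T_smul_injective k ?_
      rw [hq.T_smul_natComb, hq.T_smul_natComb, hk]
    rw [h3, sub_self] at h2
    exact T_smul_injective n (h2.trans (smul_zero _).symm)
  refine ⟨((LinearMap.ker π).liftQ _ hker).comp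
    (π.quotKerEquivOfSurjective (LinearMap.range_eq_top.1 hsurj)).symm.toLinearMap, fun v => ?_⟩
  have hv : p v = π.quotKerEquivOfSurjective (LinearMap.range_eq_top.1 hsurj)
      (Submodule.Quotient.mk (Pi.single v 1)) := by
    simp [π, Fintype.linearCombination_apply_single]
  rw [hv, LinearMap.comp_apply, LinearEquiv.coe_coe, LinearEquiv.symm_apply_apply,
    Submodule.liftQ_apply, Fintype.linearCombination_apply_single, one_smul]

/-- Finitely many cone elements have a common denominator; the sum of the individual exponents
serves as one. -/
theorem exists_matrix [Finite U] (h : A.IsDimensionModule C p) {x : U → G} (hx : ∀ u, x u ∈ C) :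
    ∃ (n : ℕ) (M : Matrix U V ℕ), ∀ u, x u = (T (-n : ℤ) : ℤ[T;T⁻¹]) • natComb p (M u) := by
  cases nonempty_fintype U
  choose n a hna using fun u => (h.mem_cone (x u)).1 (hx u)
  refine ⟨∑ u, n u, fun u => a u ᵥ* A ^ (∑ i, n i - n u), fun u => ?_⟩
  have hle : n u ≤ ∑ i, n i := Finset.single_le_sum (fun _ _ => Nat.zero_le _) (Finset.mem_univ u)
  rw [← h.intertwines.T_smul_natComb, T_smul_T_smul, hna u]
  congr 2
  omega

theorem exists_mul_pow_eq [Finite U] (h : A.IsDimensionModule C p) {M N : Matrix U V ℕ}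
    (hMN : ∀ u, natComb p (M u) = natComb p (N u)) : ∃ k : ℕ, M * A ^ k = N * A ^ k := by
  cases nonempty_fintype U
  choose k hk using fun u => h.eq_of_natComb_eq _ _ (hMN u)
  refine ⟨∑ u, k u, ?_⟩
  refine funext fun u => ?_
  have hle : k u ≤ ∑ i, k i := Finset.single_le_sum (fun _ _ => Nat.zero_le _) (Finset.mem_univ u)
  change (M u) ᵥ* _ = (N u) ᵥ* _
  rw [← Nat.add_sub_cancel' hle, pow_add, ← vecMul_vecMul, hk, vecMul_vecMul]

/-- A homomorphism of dimension modules which preserves the cones comes, up to a shift, from a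
matrix. -/
theorem exists_matrix_of_linearMap (hA : A.IsDimensionModule C p) (hB : B.IsDimensionModule D q)
    (φ : G →ₗ[ℤ[T;T⁻¹]] H) (hφ : ∀ x ∈ C, φ x ∈ D) :
    ∃ (n : ℕ) (R : Matrix V W ℕ), A * R = R * B ∧
      ∀ a, φ (natComb p a) = (T (-n : ℤ) : ℤ[T;T⁻¹]) • natComb q (a ᵥ* R) := by
  have hp : ∀ v, p v ∈ C := by
    intro v
    have := hA.natComb_mem 0 (Pi.single v 1)
    simpa [natComb] using this
  obtain ⟨n, R, hR⟩ := hB.exists_matrix fun v => hφ _ (hp v)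
  have hR' : ∀ a, φ (natComb p a) = (T (-n : ℤ) : ℤ[T;T⁻¹]) • natComb q (a ᵥ* R) := by
    intro a
    rw [LinearMap.map_natComb, natComb_vecMul, smul_natComb]
    simp only [hR]
  -- `A * R` and `R * B` are only known to agree after mapping to `H`, so `R` has to be replaced by
  -- `R * B ^ k`, compensated by `k` further shifts.
  have key : ∀ v, natComb q ((A * R) v) = natComb q ((R * B) v) := by
    intro v
    refine T_smul_injective (-n : ℤ) ?_
    have h1 := hR' (A v)
    have h2 := hB.intertwines.T_smul_natComb 1 (R v)
    rw [pow_one, Nat.cast_one] at h2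
    rw [← hA.intertwines, map_smul, hR, smul_comm, h2] at h1
    exact h1.symm
  obtain ⟨k, hk⟩ := hB.exists_mul_pow_eq key
  refine ⟨n + k, R * B ^ k, ?_, fun a => ?_⟩
  · rw [← Matrix.mul_assoc, hk, Matrix.mul_assoc, Matrix.mul_assoc, pow_mul_comm']
  · rw [hR', ← vecMul_vecMul, ← hB.intertwines.T_smul_natComb, T_smul_T_smul]
    congr 2
    push_cast
    omega

omit [DecidableEq W] in
-- Read on the generators, `ψ ∘ φ = id` says that `R * S` and `A ^ (n + m)` have rows with equal
-- images in `G`; a common power of `A` makes the rows equal.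
theorem exists_mul_mul_pow_eq (hA : A.IsDimensionModule C p)
    {φ : G →ₗ[ℤ[T;T⁻¹]] H} {ψ : H →ₗ[ℤ[T;T⁻¹]] G} (hψφ : ∀ x, ψ (φ x) = x) {n m : ℕ}
    {R : Matrix V W ℕ} {S : Matrix W V ℕ}
    (hR : ∀ a, φ (natComb p a) = (T (-n : ℤ) : ℤ[T;T⁻¹]) • natComb q (a ᵥ* R))
    (hS : ∀ a, ψ (natComb q a) = (T (-m : ℤ) : ℤ[T;T⁻¹]) • natComb p (a ᵥ* S)) :
    ∃ k : ℕ, R * S * A ^ k = A ^ (n + m) * A ^ k := by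
  refine hA.exists_mul_pow_eq fun v => ?_
  have h := hψφ (natComb p (Pi.single v 1))
  rw [hR, map_smul, hS, T_smul_T_smul, vecMul_vecMul] at h
  have h1 := congrArg (fun x => (T ((n + m : ℕ) : ℤ) : ℤ[T;T⁻¹]) • x) h
  simp only [T_smul_T_smul] at h1
  rw [hA.intertwines.T_smul_natComb, single_one_vecMul, single_one_vecMul] at h1
  rw [show ((n + m : ℕ) : ℤ) + (-(n : ℤ) + -(m : ℤ)) = 0 by push_cast; ring, T_zero, one_smul] at h1
  exact h1

/-- Shift equivalence is the same as isomorphism of ordered dimension modules. -/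
theorem shiftEquivalent_iff (hA : A.IsDimensionModule C p) (hB : B.IsDimensionModule D q) :
    A.ShiftEquivalent B ↔ ∃ φ : G ≃ₗ[ℤ[T;T⁻¹]] H, ∀ x, x ∈ C ↔ φ x ∈ D := by
  constructor
  · rintro ⟨l, -, R, S, hRS, hSR, hR, hS⟩
    obtain ⟨φ, hφ⟩ := hA.exists_linearMap (q := fun v => natComb q (R v)) fun v => by
      rw [← natComb_vecMul]
      have h := hB.intertwines.T_smul_natComb 1 (R v)
      rw [pow_one, Nat.cast_one] at h
      rw [h]
      exact congrArg (natComb q) (congrFun hR v).symm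
    obtain ⟨ψ, hψ⟩ := hB.exists_linearMap (q := fun w => natComb p (S w)) fun w => by
      rw [← natComb_vecMul]
      have h := hA.intertwines.T_smul_natComb 1 (S w)
      rw [pow_one, Nat.cast_one] at h
      rw [h]
      exact congrArg (natComb p) (congrFun hS w)
    have hφ' : ∀ a, φ (natComb p a) = natComb q (a ᵥ* R) := fun a => by
      rw [LinearMap.map_natComb, natComb_vecMul]
      simp only [hφ]
    have hψ' : ∀ b, ψ (natComb q b) = natComb p (b ᵥ* S) := fun b => by
      rw [LinearMap.map_natComb, natComb_vecMul]
      simp only [hψ]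
    have hψφ : ∀ x, ψ (φ x) = (T (l : ℤ) : ℤ[T;T⁻¹]) • x := by
      refine LinearMap.congr_fun (f := ψ.comp φ) (g := (T (l : ℤ) : ℤ[T;T⁻¹]) • LinearMap.id)
        (LinearMap.ext_on_range hA.span_range fun v => ?_)
      have h := hA.intertwines.T_smul_natComb l (Pi.single v 1)
      rw [hRS, ← vecMul_vecMul, ← hψ', ← hφ'] at h
      simpa [natComb] using h.symm
    have hφψ : ∀ x, φ (ψ x) = (T (l : ℤ) : ℤ[T;T⁻¹]) • x := by
      refine LinearMap.congr_fun (f := φ.comp ψ) (g := (T (l : ℤ) : ℤ[T;T⁻¹]) • LinearMap.id)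
        (LinearMap.ext_on_range hB.span_range fun v => ?_)
      have h := hB.intertwines.T_smul_natComb l (Pi.single v 1)
      rw [hSR, ← vecMul_vecMul, ← hφ', ← hψ'] at h
      simpa [natComb] using h.symm
    -- Both composites of `φ` and `ψ` are `x ^ l`, so `x ^ (-l) ψ` is the inverse of `φ`.
    refine ⟨LinearEquiv.ofLinearMap φ ((T (-l : ℤ) : ℤ[T;T⁻¹]) • ψ) ?_ ?_, fun x => ⟨?_, fun hx => ?_⟩⟩
    · ext1 x
      simp [hφψ, T_smul_T_smul]
    · ext1 x
      simp [hψφ, T_smul_T_smul]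
    · intro hx
      obtain ⟨n, a, rfl⟩ := (hA.mem_cone x).1 hx
      rw [LinearEquiv.coe_ofLinearMap, map_smul, hφ']
      exact hB.natComb_mem _ _
    · obtain ⟨n, a, hx⟩ := (hB.mem_cone _).1 hx
      rw [LinearEquiv.coe_ofLinearMap] at hx
      have h := congrArg ψ hx
      rw [map_smul, hψ', hψφ] at h
      have h' := congrArg (fun y => (T (-l : ℤ) : ℤ[T;T⁻¹]) • y) h
      simp only [T_smul_T_smul, neg_add_cancel, T_zero, one_smul] at h'
      rw [h']
      exact hA.natComb_mem _ _
  · rintro ⟨φ, hφ⟩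
    obtain ⟨n, R, hR, hR'⟩ := hA.exists_matrix_of_linearMap hB φ.toLinearMap fun x hx => (hφ x).1 hx
    obtain ⟨m, S, hS, hS'⟩ := hB.exists_matrix_of_linearMap hA φ.symm.toLinearMap fun x hx =>
      (hφ _).2 (by simpa using hx)
    obtain ⟨i, hi⟩ := hA.exists_mul_mul_pow_eq (fun x => φ.symm_apply_apply x) hR' hS'
    obtain ⟨j, hj⟩ := hB.exists_mul_mul_pow_eq (fun x => φ.apply_symm_apply x) hS' hR'
    have hcomm : ∀ k : ℕ, S * A ^ k = B ^ k * S := by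
      intro k
      induction k with
      | zero => simp
      | succ k ih =>
        rw [pow_succ, ← Matrix.mul_assoc, ih, Matrix.mul_assoc, ← hS, ← Matrix.mul_assoc,
          ← pow_succ]
    have hcomm' : ∀ k : ℕ, A ^ k * R = R * B ^ k := by
      intro k
      induction k with
      | zero => simp
      | succ k ih =>
        rw [pow_succ, Matrix.mul_assoc, hR, ← Matrix.mul_assoc, ih, Matrix.mul_assoc, ← pow_succ]
    -- The surplus power `i + j` covers both identities `hi` and `hj`, and the extra `1` forces a
    -- positive lag.
    refine ⟨n + m + (i + j + 1), by omega, R, S * A ^ (i + j + 1), ?_, ?_, hR, ?_⟩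
    · rw [← Matrix.mul_assoc, add_assoc i, pow_add A i, ← Matrix.mul_assoc, hi, ← pow_add,
        ← pow_add]
      congr 1
      omega
    · rw [Matrix.mul_assoc, hcomm', ← Matrix.mul_assoc, show i + j + 1 = j + (i + 1) by omega,
        pow_add B j, ← Matrix.mul_assoc, hj, ← pow_add, ← pow_add]
      congr 1
      omega
    · rw [Matrix.mul_assoc, ← pow_succ, pow_succ', ← Matrix.mul_assoc, ← Matrix.mul_assoc, ← hS]

end Matrix.IsDimensionModule

end DimensionModule

section

/-! ### Paths in a graph and the corresponding elements of the Leavitt path algebra -/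

/-- Paths of length `k` starting at a given vertex. -/
def Quiver.Walk (V : Type u) [Quiver.{v} V] : ℕ → V → Type (max u v)
  | 0, _ => PUnit
  | k + 1, a => Σ b : V, Σ _ : a ⟶ b, Quiver.Walk V k b

namespace Quiver.Walk

variable {V : Type u} [Quiver.{v} V]

noncomputable instance fintype [Fintype V] [∀ a b : V, Fintype (a ⟶ b)] :
    ∀ (k : ℕ) (a : V), Fintype (Walk V k a)
  | 0, _ => inferInstanceAs (Fintype PUnit)
  | k + 1, a =>
    haveI := fun b => fintype k b
    inferInstanceAs (Fintype (Σ b : V, Σ _ : a ⟶ b, Walk V k b))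

/-- The range of a path. -/
def finish : ∀ {k : ℕ} {a : V}, Walk V k a → V
  | 0, a, _ => a
  | _ + 1, _, p => finish p.2.2

/-- Splitting off the first edge matches `A ^ (k + 1) = A * A ^ k`. This is how powers of the
adjacency matrix enter the refinement of frames. -/
theorem card_finish_eq [Fintype V] [DecidableEq V] [∀ a b : V, Fintype (a ⟶ b)] (k : ℕ) (a c : V) :
    ∑ p : Walk V k a, (if p.finish = c then 1 else 0) = (Quiver.adjacency V ^ k) a c := by
  induction k generalizing a with
  | zero =>
    rw [pow_zero, Matrix.one_apply]
    exact Fintype.sum_unique (ι := PUnit) fun _ => if a = c then 1 else 0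
  | succ k ih =>
    rw [pow_succ', Matrix.mul_apply]
    refine (Fintype.sum_sigma (α := fun b => Σ _ : a ⟶ b, Walk V k b) _).trans
      (Finset.sum_congr rfl fun b _ => ?_)
    refine (Fintype.sum_sigma (α := fun _ : a ⟶ b => Walk V k b) _).trans ?_
    refine (Finset.sum_congr rfl fun α _ => ih b).trans ?_
    rw [Finset.sum_const, smul_eq_mul, Finset.card_univ]
    rfl

end Quiver.Walk

open Quiver

namespace LeavittPathAlgebra

section Relations

variable (K : Type w) [CommRing K] {V : Type u} [Quiver.{v} V] [Fintype V]
  [∀ a b : V, Fintype (a ⟶ b)]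

/-- The idempotent of a vertex. -/
noncomputable def vtx (a : V) : LeavittPathAlgebra K V := gen K V (.vertex a)

/-- The element of an edge. -/
noncomputable def edg (e : Total V) : LeavittPathAlgebra K V := gen K V (.edge e)

/-- The element of a ghost edge. -/
noncomputable def gho (e : Total V) : LeavittPathAlgebra K V := gen K V (.ghost e)

theorem vtx_mul_self (a : V) : vtx K a * vtx K a = vtx K a := by
  simpa only [map_mul, vtx, edg, gho, gen] using mk_eq_of_rel K V (.vertex_mul_self a)

variable {K} in
theorem vtx_mul_of_ne {a b : V} (h : a ≠ b) : vtx K a * vtx K b = 0 := by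
  simpa only [map_mul, map_zero, vtx, edg, gho, gen] using mk_eq_of_rel K V (.vertex_mul_of_ne a b h)

theorem vtx_mul_edg (e : Total V) : vtx K e.left * edg K e = edg K e := by
  simpa only [map_mul, vtx, edg, gho, gen] using mk_eq_of_rel K V (.source_mul_edge e)

theorem edg_mul_vtx (e : Total V) : edg K e * vtx K e.right = edg K e := by
  simpa only [map_mul, vtx, edg, gho, gen] using mk_eq_of_rel K V (.edge_mul_range e)

theorem vtx_mul_gho (e : Total V) : vtx K e.right * gho K e = gho K e := by
  simpa only [map_mul, vtx, edg, gho, gen] using mk_eq_of_rel K V (.range_mul_ghost e)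

theorem gho_mul_vtx (e : Total V) : gho K e * vtx K e.left = gho K e := by
  simpa only [map_mul, vtx, edg, gho, gen] using mk_eq_of_rel K V (.ghost_mul_source e)

theorem gho_mul_edg_self (e : Total V) : gho K e * edg K e = vtx K e.right := by
  simpa only [map_mul, vtx, edg, gho, gen] using mk_eq_of_rel K V (.ghost_mul_edge_self e)

variable {K} in
theorem gho_mul_edg_of_ne {e f : Total V} (h : e ≠ f) : gho K e * edg K f = 0 := by
  simpa only [map_mul, map_zero, vtx, edg, gho, gen] using mk_eq_of_rel K V (.ghost_mul_edge_of_ne e f h)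

variable {K} in
theorem sum_edg_mul_gho (hV : NoSinks V) (a : V) :
    ∑ b : V, ∑ α : a ⟶ b, edg K ⟨a, b, α⟩ * gho K ⟨a, b, α⟩ = vtx K a := by
  simpa only [map_mul, map_sum, vtx, edg, gho, gen] using mk_eq_of_rel K V (.sum_edge_mul_ghost a (hV a))

theorem sum_vtx : ∑ a : V, vtx K a = 1 := by
  simpa only [map_sum, map_one, vtx, edg, gho, gen] using mk_eq_of_rel K V .sum_vertex

variable (V) in
theorem vtx_mem_grading (a : V) : vtx K a ∈ grading K V 0 := gen_mem_grading K V (.vertex a)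

/-- The element of a path. -/
noncomputable def path : ∀ {k : ℕ} {a : V}, Walk V k a → LeavittPathAlgebra K V
  | 0, a, _ => vtx K a
  | _ + 1, a, p => edg K ⟨a, p.1, p.2.1⟩ * path p.2.2

/-- The element of a ghost path. -/
noncomputable def ghostPath : ∀ {k : ℕ} {a : V}, Walk V k a → LeavittPathAlgebra K V
  | 0, a, _ => vtx K a
  | _ + 1, a, p => ghostPath p.2.2 * gho K ⟨a, p.1, p.2.1⟩

variable {k : ℕ} {a b : V}

theorem vtx_mul_path (p : Walk V k a) : vtx K a * path K p = path K p := by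
  cases k with
  | zero => exact vtx_mul_self K a
  | succ k =>
    change vtx K a * (edg K ⟨a, p.1, p.2.1⟩ * path K p.2.2) = _
    rw [← mul_assoc, vtx_mul_edg K ⟨a, p.1, p.2.1⟩]
    rfl

theorem ghostPath_mul_vtx (p : Walk V k a) : ghostPath K p * vtx K a = ghostPath K p := by
  cases k with
  | zero => exact vtx_mul_self K a
  | succ k =>
    change ghostPath K p.2.2 * gho K ⟨a, p.1, p.2.1⟩ * vtx K a = _
    rw [mul_assoc, gho_mul_vtx K ⟨a, p.1, p.2.1⟩]
    rfl

theorem path_mul_vtx (p : Walk V k a) : path K p * vtx K p.finish = path K p := by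
  induction k generalizing a with
  | zero => exact vtx_mul_self K a
  | succ k ih =>
    change edg K ⟨a, p.1, p.2.1⟩ * path K p.2.2 * vtx K p.2.2.finish = _
    rw [mul_assoc, ih]
    rfl

theorem vtx_mul_ghostPath (p : Walk V k a) : vtx K p.finish * ghostPath K p = ghostPath K p := by
  induction k generalizing a with
  | zero => exact vtx_mul_self K a
  | succ k ih =>
    change vtx K p.2.2.finish * (ghostPath K p.2.2 * gho K ⟨a, p.1, p.2.1⟩) = _
    rw [← mul_assoc, ih]
    rfl

theorem path_mem_grading (p : Walk V k a) : path K p ∈ grading K V k := by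
  induction k generalizing a with
  | zero => exact vtx_mem_grading K V a
  | succ k ih =>
    have h := SetLike.GradedMul.mul_mem (gen_mem_grading K V (.edge ⟨a, p.1, p.2.1⟩)) (ih p.2.2)
    rwa [LeavittGen.degree, add_comm, ← Nat.cast_succ] at h

theorem ghostPath_mem_grading (p : Walk V k a) : ghostPath K p ∈ grading K V (-k) := by
  induction k generalizing a with
  | zero => exact vtx_mem_grading K V a
  | succ k ih =>
    have h := SetLike.GradedMul.mul_mem (ih p.2.2) (gen_mem_grading K V (.ghost ⟨a, p.1, p.2.1⟩))
    rwa [LeavittGen.degree, ← neg_add, ← Nat.cast_succ] at h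

theorem ghostPath_mul_path_self (p : Walk V k a) : ghostPath K p * path K p = vtx K p.finish := by
  induction k generalizing a with
  | zero => exact vtx_mul_self K a
  | succ k ih =>
    change ghostPath K p.2.2 * gho K ⟨a, p.1, p.2.1⟩ * (edg K ⟨a, p.1, p.2.1⟩ * path K p.2.2) =
      vtx K p.2.2.finish
    rw [mul_assoc, ← mul_assoc (gho K _), gho_mul_edg_self, vtx_mul_path, ih]

-- Compare first edges: if they differ, the inner product of ghost edge and edge is zero; if they
-- agree, it collapses to a vertex and the tails must differ.
variable {K} in
theorem ghostPath_mul_path_of_ne {p q : Walk V k a} (h : p ≠ q) :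
    ghostPath K p * path K q = 0 := by
  induction k generalizing a with
  | zero => exact absurd rfl h
  | succ k ih =>
    obtain ⟨b, α, p⟩ := p
    obtain ⟨c, β, q⟩ := q
    change ghostPath K p * gho K ⟨a, b, α⟩ * (edg K ⟨a, c, β⟩ * path K q) = 0
    rw [mul_assoc, ← mul_assoc (gho K _)]
    by_cases he : (⟨a, b, α⟩ : Total V) = ⟨a, c, β⟩
    · cases he
      rw [gho_mul_edg_self, vtx_mul_path]
      refine ih fun hpq => h ?_
      rw [hpq]
    · rw [gho_mul_edg_of_ne he, zero_mul, mul_zero]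

variable {K} in
theorem ghostPath_mul_path_of_source_ne {l : ℕ} (h : a ≠ b) (p : Walk V k a) (q : Walk V l b) :
    ghostPath K p * path K q = 0 := by
  rw [← ghostPath_mul_vtx, ← vtx_mul_path K q, mul_assoc, ← mul_assoc (vtx K a), vtx_mul_of_ne h,
    zero_mul, mul_zero]

theorem exists_ghostPath_mul_path (p : Walk V k a) (q : Walk V k b) :
    ∃ c : K, ghostPath K p * path K q = c • vtx K p.finish := by
  by_cases h : a = b
  · subst h
    by_cases h : p = q
    · subst h
      exact ⟨1, by rw [one_smul, ghostPath_mul_path_self]⟩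
    · exact ⟨0, by rw [zero_smul, ghostPath_mul_path_of_ne h]⟩
  · exact ⟨0, by rw [zero_smul, ghostPath_mul_path_of_source_ne h]⟩

-- The relation `∑ α α* = v` is iterated along paths; it is available at every vertex because there
-- are no sinks.
variable {K} in
theorem sum_path_mul_ghostPath (hV : NoSinks V) (k : ℕ) (a : V) :
    ∑ p : Walk V k a, path K p * ghostPath K p = vtx K a := by
  induction k generalizing a with
  | zero =>
    exact (Fintype.sum_unique (ι := PUnit) fun _ => vtx K a * vtx K a).trans (vtx_mul_self K a)
  | succ k ih =>
    rw [← sum_edg_mul_gho hV]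
    refine (Fintype.sum_sigma (α := fun b => Σ _ : a ⟶ b, Walk V k b) _).trans
      (Finset.sum_congr rfl fun b _ => ?_)
    refine (Fintype.sum_sigma (α := fun _ : a ⟶ b => Walk V k b) _).trans
      (Finset.sum_congr rfl fun α _ => ?_)
    have h : ∀ p : Walk V k b, path K (k := k + 1) (a := a) ⟨b, α, p⟩ *
        ghostPath K (k := k + 1) (a := a) ⟨b, α, p⟩ =
        edg K ⟨a, b, α⟩ * (path K p * ghostPath K p) * gho K ⟨a, b, α⟩ := fun p => by
      change edg K ⟨a, b, α⟩ * path K p * (ghostPath K p * gho K ⟨a, b, α⟩) = _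
      simp only [mul_assoc]
    refine (Finset.sum_congr rfl fun p _ => h p).trans ?_
    rw [← Finset.sum_mul, ← Finset.mul_sum, ih, edg_mul_vtx K ⟨a, b, α⟩]

/-! ### Homogeneous elements as scalar matrices -/

/-- The predicate that an element of degree `n` becomes a matrix with scalar entries when it is
expanded along paths of any sufficiently large length. -/
def EventuallyScalar (n : ℤ) (x : LeavittPathAlgebra K V) : Prop :=
  ∃ k₀ : ℕ, ∀ i j : ℕ, k₀ ≤ j → (i : ℤ) = j + n → ∀ (a b : V) (p : Walk V i a) (q : Walk V j b),
    ∃ c : K, ghostPath K p * x * path K q = c • vtx K p.finish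

namespace EventuallyScalar

variable {K} {m n : ℤ} {x y : LeavittPathAlgebra K V}

theorem add (hx : EventuallyScalar K n x) (hy : EventuallyScalar K n y) :
    EventuallyScalar K n (x + y) := by
  obtain ⟨k, hk⟩ := hx
  obtain ⟨l, hl⟩ := hy
  refine ⟨k + l, fun i j hj hij a b p q => ?_⟩
  obtain ⟨c, hc⟩ := hk i j (by omega) hij a b p q
  obtain ⟨d, hd⟩ := hl i j (by omega) hij a b p q
  exact ⟨c + d, by rw [mul_add, add_mul, hc, hd, add_smul]⟩

theorem smul (r : K) (hx : EventuallyScalar K n x) : EventuallyScalar K n (r • x) := by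
  obtain ⟨k, hk⟩ := hx
  refine ⟨k, fun i j hj hij a b p q => ?_⟩
  obtain ⟨c, hc⟩ := hk i j hj hij a b p q
  exact ⟨r * c, by rw [mul_smul_comm, smul_mul_assoc, hc, mul_smul]⟩

variable (K V n) in
theorem zero : EventuallyScalar K n (0 : LeavittPathAlgebra K V) :=
  ⟨0, fun i j _ _ a b p q => ⟨0, by rw [mul_zero, zero_mul, zero_smul]⟩⟩

variable (K V) in
theorem one : EventuallyScalar K 0 (1 : LeavittPathAlgebra K V) := by
  refine ⟨0, fun i j _ hij a b p q => ?_⟩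
  obtain rfl : i = j := by omega
  rw [mul_one]
  exact exists_ghostPath_mul_path K p q

/-- Inserting `1 = ∑ r r*` over the paths of the intermediate length turns the product into a matrix
product of scalar matrices. -/
theorem mul (hV : NoSinks V) (hx : EventuallyScalar K m x) (hy : EventuallyScalar K n y) :
    EventuallyScalar K (m + n) (x * y) := by
  classical
  obtain ⟨k, hk⟩ := hx
  obtain ⟨l, hl⟩ := hy
  -- The summand `|n|` ensures that `j + n` is nonnegative and at least `k`, so that `toNat` returns
  -- the true length.
  refine ⟨k + l + n.natAbs, fun i j hj hij a b p q => ?_⟩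
  have h1 : (1 : LeavittPathAlgebra K V) =
      ∑ c : V, ∑ r : Walk V (j + n).toNat c, path K r * ghostPath K r := by
    rw [← sum_vtx]
    exact Finset.sum_congr rfl fun c _ => (sum_path_mul_ghostPath hV _ c).symm
  have h2 : ∀ (c : V) (r : Walk V (j + n).toNat c), ∃ d : K,
      ghostPath K p * x * (path K r * ghostPath K r) * (y * path K q) = d • vtx K p.finish := by
    intro c r
    obtain ⟨d, hd⟩ := hk i _ (by omega) (by omega) a c p r
    obtain ⟨e, he⟩ := hl _ j (by omega) (by omega) c b r q
    have h3 : ghostPath K p * x * (path K r * ghostPath K r) * (y * path K q) =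
        (ghostPath K p * x * path K r) * (ghostPath K r * y * path K q) := by
      simp only [mul_assoc]
    rw [h3, hd, he, smul_mul_smul_comm]
    by_cases h : p.finish = r.finish
    · exact ⟨d * e, by rw [h, vtx_mul_self]⟩
    · exact ⟨0, by rw [vtx_mul_of_ne h, smul_zero, zero_smul]⟩
  choose d hd using h2
  refine ⟨∑ c : V, ∑ r : Walk V (j + n).toNat c, d c r, ?_⟩
  calc ghostPath K p * (x * y) * path K q = ghostPath K p * x * 1 * (y * path K q) := by
        simp only [mul_assoc, one_mul]
    _ = _ := by
        rw [h1]
        simp only [Finset.mul_sum, Finset.sum_mul, Finset.sum_smul, hd]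

theorem gen (g : LeavittGen V) : EventuallyScalar K g.degree (gen K V g) := by
  refine ⟨0, fun i j _ hij a b p q => ?_⟩
  cases g with
  | vertex c =>
    obtain rfl : i = j := by
      rw [LeavittGen.degree] at hij
      omega
    change ∃ d : K, ghostPath K p * vtx K c * path K q = d • _
    by_cases h : c = b
    · subst h
      rw [mul_assoc, vtx_mul_path]
      exact exists_ghostPath_mul_path K p q
    · refine ⟨0, ?_⟩
      rw [mul_assoc, ← vtx_mul_path K q, ← mul_assoc (vtx K c), vtx_mul_of_ne h, zero_mul, mul_zero,
        zero_smul]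
  | edge e =>
    obtain rfl : i = j + 1 := by
      rw [LeavittGen.degree] at hij
      omega
    change ∃ d : K, ghostPath K p * edg K e * path K q = d • _
    by_cases h : e.right = b
    · subst h
      rw [mul_assoc]
      -- Prepending `e` to `q` gives a path of the same length as `p`.
      exact exists_ghostPath_mul_path K p (⟨e.right, e.hom, q⟩ : Walk V (j + 1) e.left)
    · refine ⟨0, ?_⟩
      rw [mul_assoc, ← vtx_mul_path K q, ← mul_assoc (edg K e), ← edg_mul_vtx,
        mul_assoc (edg K e), vtx_mul_of_ne h, mul_zero, zero_mul, mul_zero, zero_smul]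
  | ghost e =>
    obtain rfl : j = i + 1 := by
      rw [LeavittGen.degree] at hij
      omega
    change ∃ d : K, ghostPath K p * gho K e * path K q = d • _
    by_cases h : e.right = a
    · subst h
      exact exists_ghostPath_mul_path K (⟨e.right, e.hom, p⟩ : Walk V (i + 1) e.left) q
    · refine ⟨0, ?_⟩
      rw [← ghostPath_mul_vtx, mul_assoc (ghostPath K p), ← vtx_mul_gho,
        ← mul_assoc (vtx K a), vtx_mul_of_ne (Ne.symm h), zero_mul, mul_zero, zero_mul, zero_smul]

theorem of_mem_grading (hV : NoSinks V) (hx : x ∈ grading K V n) : EventuallyScalar K n x := by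
  induction hx using Submodule.span_induction with
  | mem x h =>
    obtain ⟨l, rfl, rfl⟩ := h
    induction l with
    | nil => exact one K V
    | cons g l ih =>
      simp only [List.map_cons, List.sum_cons, List.prod_cons]
      exact (gen g).mul hV ih
  | zero => exact zero K V n
  | add x y _ _ hx hy => exact hx.add hy
  | smul r x _ hx => exact hx.smul r

end EventuallyScalar

variable {K} in
/-- Degree zero elements become scalar matrices when expanded along long enough paths. -/
theorem exists_ghostPath_mul_mul_path (hV : NoSinks V) {x : LeavittPathAlgebra K V}
    (hx : x ∈ grading K V 0) :
    ∃ k₀ : ℕ, ∀ k, k₀ ≤ k → ∀ (a b : V) (p : Walk V k a) (q : Walk V k b),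
      ∃ c : K, ghostPath K p * x * path K q = c • vtx K p.finish := by
  obtain ⟨k₀, h⟩ := EventuallyScalar.of_mem_grading hV hx
  exact ⟨k₀, fun k hk => h k k hk (by simp)⟩

end Relations

/-! ### A representation on functions in which no vertex is annihilated by a nonzero scalar -/

section Representation

variable {K : Type w} [CommRing K] {V : Type u} [Quiver.{v} V] [Fintype V]
  [∀ a b : V, Fintype (a ⟶ b)]

/-- Bijections which identify `ℕ`, attached to a vertex `a`, with the disjoint union of copies of `ℕ`
indexed by the edges emitted by `a`. -/
theorem exists_unfolding (hV : NoSinks V) :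
    Nonempty (∀ a : V, (Σ b : V, (a ⟶ b) × ℕ) ≃ ℕ) := by
  refine ⟨fun a => Classical.choice ?_⟩
  obtain ⟨b, ⟨α⟩⟩ := hV a
  have : Infinite (Σ b : V, (a ⟶ b) × ℕ) :=
    Infinite.of_injective (fun n : ℕ => (⟨b, α, n⟩ : Σ b : V, (a ⟶ b) × ℕ)) fun m n h => by
      simpa using h
  exact nonempty_equiv_of_countable

open Classical in
/-- The action of the generators of the Leavitt path algebra on functions on `V × ℕ`. -/
noncomputable def repGen (φ : ∀ a : V, (Σ b : V, (a ⟶ b) × ℕ) ≃ ℕ) :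
    LeavittGen V → Module.End K (V × ℕ → K)
  | .vertex a =>
    { toFun := fun f x => if x.1 = a then f x else 0
      map_add' := fun f g => by ext x; simp only [Pi.add_apply]; split_ifs <;> simp
      map_smul' := fun c f => by ext x; simp }
  | .edge e =>
    { toFun := fun f x =>
        if (⟨x.1, ((φ x.1).symm x.2).1, ((φ x.1).symm x.2).2.1⟩ : Total V) = e then
          f (((φ x.1).symm x.2).1, ((φ x.1).symm x.2).2.2) else 0
      map_add' := fun f g => by ext x; simp only [Pi.add_apply]; split_ifs <;> simp
      map_smul' := fun c f => by ext x; simp }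
  | .ghost e =>
    { toFun := fun f x => if x.1 = e.right then f (e.left, φ e.left ⟨e.right, e.hom, x.2⟩) else 0
      map_add' := fun f g => by ext x; simp only [Pi.add_apply]; split_ifs <;> simp
      map_smul' := fun c f => by ext x; simp }

section

omit [Fintype V] [∀ a b : V, Fintype (a ⟶ b)]

variable (φ : ∀ a : V, (Σ b : V, (a ⟶ b) × ℕ) ≃ ℕ) (f : V × ℕ → K) (x : V × ℕ)

open Classical in
theorem repGen_vertex (a : V) :
    repGen φ (.vertex a) f x = if x.1 = a then f x else 0 := rfl

open Classical in
theorem repGen_edge (e : Total V) (a b : V) (α : a ⟶ b) (n : ℕ) :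
    repGen φ (.edge e) f (a, φ a ⟨b, α, n⟩) = if ⟨a, b, α⟩ = e then f (b, n) else 0 := by
  change (if (⟨a, ((φ a).symm (φ a ⟨b, α, n⟩)).1, ((φ a).symm (φ a ⟨b, α, n⟩)).2.1⟩ : Total V) = e
    then f (((φ a).symm (φ a ⟨b, α, n⟩)).1, ((φ a).symm (φ a ⟨b, α, n⟩)).2.2) else 0) = _
  rw [Equiv.symm_apply_apply]

open Classical in
theorem repGen_ghost (e : Total V) :
    repGen φ (.ghost e) f x =
      if x.1 = e.right then f (e.left, φ e.left ⟨e.right, e.hom, x.2⟩) else 0 := rfl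

end

/-- Through `φ a`, the fibre over `a` is partitioned into copies of the fibres over the ranges of
the edges leaving `a`. An edge extends a function by zero from its piece and a ghost edge restricts
to that piece; disjointness and covering of the pieces give the last two Leavitt relations. -/
theorem repGen_rel (φ : ∀ a : V, (Σ b : V, (a ⟶ b) × ℕ) ≃ ℕ)
    {x y : FreeAlgebra K (LeavittGen V)} (h : LeavittRel K V x y) :
    FreeAlgebra.lift K (repGen (K := K) φ) x = FreeAlgebra.lift K (repGen (K := K) φ) y := by
  classical
  have hx : ∀ x : V × ℕ, ∃ (a b : V) (α : a ⟶ b) (n : ℕ), x = (a, φ a ⟨b, α, n⟩) := by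
    rintro ⟨a, m⟩
    obtain ⟨⟨b, α, n⟩, rfl⟩ := (φ a).surjective m
    exact ⟨a, b, α, n, rfl⟩
  refine LinearMap.ext fun f => funext fun x => ?_
  cases h with
  | vertex_mul_self a =>
    simp only [map_mul, FreeAlgebra.lift_ι_apply, Module.End.mul_apply, repGen_vertex]
    split_ifs <;> rfl
  | vertex_mul_of_ne a b h =>
    simp only [map_mul, map_zero, FreeAlgebra.lift_ι_apply, Module.End.mul_apply, repGen_vertex]
    split_ifs with h1 h2
    · exact absurd (h1.symm.trans h2) h
    · rfl
    · rfl
  | source_mul_edge e =>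
    obtain ⟨a, b, α, n, rfl⟩ := hx x
    simp only [map_mul, FreeAlgebra.lift_ι_apply, Module.End.mul_apply, repGen_vertex, repGen_edge]
    split_ifs with h1 h2 h2
    · rfl
    · rfl
    · exact absurd (congrArg Total.left h2) h1
    · rfl
  | edge_mul_range e =>
    obtain ⟨a, b, α, n, rfl⟩ := hx x
    simp only [map_mul, FreeAlgebra.lift_ι_apply, Module.End.mul_apply, repGen_vertex, repGen_edge]
    split_ifs with h1 h2
    · rfl
    · exact absurd (congrArg Total.right h1) h2
    · rfl
  | range_mul_ghost e =>
    simp only [map_mul, FreeAlgebra.lift_ι_apply, Module.End.mul_apply, repGen_vertex, repGen_ghost]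
    split_ifs <;> rfl
  | ghost_mul_source e =>
    simp only [map_mul, FreeAlgebra.lift_ι_apply, Module.End.mul_apply, repGen_vertex, repGen_ghost,
      if_true]
  | ghost_mul_edge_self e =>
    simp only [map_mul, FreeAlgebra.lift_ι_apply, Module.End.mul_apply, repGen_vertex, repGen_ghost,
      repGen_edge, if_true]
    split_ifs with h
    · rw [← h]
    · rfl
  | ghost_mul_edge_of_ne e f h =>
    simp only [map_mul, map_zero, FreeAlgebra.lift_ι_apply, Module.End.mul_apply, repGen_ghost,
      repGen_edge, if_neg h, ite_self]
    rfl
  | sum_edge_mul_ghost a h =>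
    obtain ⟨c, b, α, n, rfl⟩ := hx x
    simp only [map_sum, map_mul, FreeAlgebra.lift_ι_apply, LinearMap.sum_apply, Finset.sum_apply,
      Module.End.mul_apply, repGen_vertex, repGen_ghost, repGen_edge]
    by_cases hc : c = a
    · subst hc
      rw [Finset.sum_eq_single b, Finset.sum_eq_single α]
      · simp
      · intro β _ hβ
        rw [if_neg]
        intro he
        cases he
        exact hβ rfl
      · simp
      · intro b' _ hb
        refine Finset.sum_eq_zero fun β _ => if_neg fun he => hb ?_
        exact (congrArg Total.right he).symm
      · simp
    · rw [if_neg hc]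
      exact Finset.sum_eq_zero fun b _ => Finset.sum_eq_zero fun β _ =>
        if_neg fun he => hc (congrArg Total.left he)
  | sum_vertex =>
    simp only [map_sum, map_one, FreeAlgebra.lift_ι_apply, LinearMap.sum_apply, Finset.sum_apply,
      repGen_vertex, Module.End.one_apply]
    simp

/-- In a graph without sinks, multiples of a vertex are determined by the scalar. -/
theorem smul_vtx_eq_zero (hV : NoSinks V) {c : K} {a : V} (h : c • vtx K a = 0) : c = 0 := by
  obtain ⟨φ⟩ := exists_unfolding hV
  let ρ : LeavittPathAlgebra K V →ₐ[K] Module.End K (V × ℕ → K) :=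
    RingQuot.liftAlgHom K ⟨FreeAlgebra.lift K (repGen (K := K) φ), fun _ _ h => repGen_rel φ h⟩
  have hρ : ρ (vtx K a) = repGen φ (.vertex a) := by
    rw [vtx, gen, RingQuot.liftAlgHom_mkAlgHom_apply, FreeAlgebra.lift_ι_apply]
  have h1 := congrArg ρ h
  rw [map_smul, map_zero, hρ] at h1
  -- At the point `(a, 0)`, the vertex operator applied to the constant function `1` has value `1`.
  have h2 := congrFun (LinearMap.congr_fun h1 fun _ => 1) (a, 0)
  rw [LinearMap.smul_apply, Pi.smul_apply, repGen_vertex] at h2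
  simpa using h2

end Representation

end LeavittPathAlgebra

end

/-! ### Graded dual bases -/

section RightModules

variable {A : Type*} [Ring A]

open MulOpposite

/-- Left multiplication, as a homomorphism of right modules. -/
def LinearMap.mulLeftOp (a : A) : A →ₗ[Aᵐᵒᵖ] A where
  toFun x := a * x
  map_add' := mul_add a
  map_smul' r x := (mul_assoc a x r.unop).symm

@[simp] theorem LinearMap.mulLeftOp_apply (a x : A) : LinearMap.mulLeftOp a x = a * x := rfl

variable {M : Type*} [AddCommGroup M] [Module Aᵐᵒᵖ M]

/-- The homomorphism of right modules `a ↦ m a`. -/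
def LinearMap.opSpanSingleton (m : M) : A →ₗ[Aᵐᵒᵖ] M where
  toFun x := op x • m
  map_add' x y := by rw [op_add, add_smul]
  map_smul' r x := (mul_smul r (op x) m)

@[simp] theorem LinearMap.opSpanSingleton_apply (m : M) (x : A) :
    LinearMap.opSpanSingleton m x = op x • m := rfl

/-- The right regular module is free of rank one. -/
def LinearEquiv.opSelf : A ≃ₗ[Aᵐᵒᵖ] Aᵐᵒᵖ where
  toFun := op
  invFun := unop
  left_inv _ := rfl
  right_inv _ := rfl
  map_add' _ _ := rfl
  map_smul' _ _ := rfl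

theorem map_op_smul (f : M →ₗ[Aᵐᵒᵖ] A) (a : A) (m : M) : f (op a • m) = f m * a :=
  map_smul f (op a) m

theorem op_sum_smul {ι : Type*} (s : Finset ι) (a : ι → A) (m : M) :
    op (∑ i ∈ s, a i) • m = ∑ i ∈ s, op (a i) • m := by
  rw [Finset.op_sum, Finset.sum_smul]

end RightModules

namespace GradedProj

open MulOpposite

variable {σ : Type*} {A : Type u} [Ring A] [SetLike σ A] [AddSubgroupClass σ A]
  {𝒜 : ℤ → σ} [GradedRing 𝒜]

/-- The decomposition of a graded module into its components. -/
noncomputable abbrev decomposition (P : GradedProj 𝒜) : DirectSum.Decomposition P.component :=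
  P.isInternal.chooseDecomposition

theorem decompose_op_smul (P : GradedProj 𝒜) [DirectSum.Decomposition P.component] {d : ℤ}
    {m : P.carrier} (hm : m ∈ P.component d) (a : A) (j : ℤ) :
    (DirectSum.decompose P.component (op a • m) j : P.carrier) =
      op (DirectSum.decompose 𝒜 a (j - d) : A) • m := by
  induction a using DirectSum.Decomposition.inductionOn 𝒜 with
  | zero => simp
  | @homogeneous k a =>
    have h := P.smul_mem hm a.2
    by_cases hj : d + k = j
    · subst hj
      rw [DirectSum.decompose_of_mem_same _ h, add_sub_cancel_left,
        DirectSum.decompose_of_mem_same _ a.2]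
    · rw [DirectSum.decompose_of_mem_ne _ h hj,
        DirectSum.decompose_of_mem_ne _ a.2 (by omega : k ≠ j - d), op_zero, zero_smul]
  | add a b ha hb =>
    simp only [op_add, add_smul, DirectSum.decompose_add, DirectSum.add_apply,
      AddMemClass.coe_add, ha, hb]

/-- The degree preserving part of a homomorphism from a graded module to the shifted ring. -/
theorem exists_homogeneous_part (P : GradedProj 𝒜) (d : ℤ) (f₀ : P.carrier →ₗ[Aᵐᵒᵖ] A) :
    ∃ f : P.carrier →ₗ[Aᵐᵒᵖ] A, ∀ j, ∀ x ∈ P.component j,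
      f x = DirectSum.decompose 𝒜 (f₀ x) (j - d) := by
  let := P.decomposition
  -- On the component of degree `j`, keep only the part of `f₀` in degree `j - d`.
  let F : P.carrier →+ A :=
    (DirectSum.toAddMonoid fun j => ((GradedRing.proj 𝒜 (j - d)).comp f₀.toAddMonoidHom).comp
      (P.component j).subtype).comp (DirectSum.decomposeAddEquiv P.component).toAddMonoidHom
  have hF : ∀ j, ∀ x ∈ P.component j, F x = DirectSum.decompose 𝒜 (f₀ x) (j - d) := by
    intro j x hx
    change DirectSum.toAddMonoid _ (DirectSum.decompose P.component x) = _
    rw [DirectSum.decompose_of_mem _ hx, DirectSum.toAddMonoid_of]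
    rfl
  have hmul : ∀ (x : P.carrier) (a : A), F (op a • x) = F x * a := by
    intro x a
    induction x using DirectSum.Decomposition.inductionOn P.component with
    | zero => simp
    | @homogeneous j x =>
      induction a using DirectSum.Decomposition.inductionOn 𝒜 with
      | zero => simp
      | @homogeneous k a =>
        rw [hF _ _ (P.smul_mem x.2 a.2), hF _ _ x.2, map_op_smul, add_sub_right_comm,
          DirectSum.coe_decompose_mul_add_of_right_mem 𝒜 a.2]
      | add a b ha hb => rw [op_add, add_smul, map_add, ha, hb, mul_add]
    | add x y hx hy => rw [smul_add, map_add, hx, hy, map_add, add_mul]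
  exact ⟨{ F with map_smul' := fun r x => hmul x r.unop }, hF⟩

/-- A graded finitely generated projective module has a finite dual basis consisting of homogeneous
elements and homogeneous functionals. -/
theorem exists_dualBasis (P : GradedProj 𝒜) :
    ∃ (ι : Type u) (_ : Fintype ι) (d : ι → ℤ) (m : ι → P.carrier)
      (f : ι → P.carrier →ₗ[Aᵐᵒᵖ] A), (∀ i, m i ∈ P.component (d i)) ∧
      (∀ i j, ∀ x ∈ P.component j, f i x ∈ 𝒜 (j - d i)) ∧ ∀ x, ∑ i, op (f i x) • m i = x := by
  classical
  let := P.decomposition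
  have hspan : Submodule.span Aᵐᵒᵖ {x : P.carrier | ∃ j, x ∈ P.component j} = ⊤ := by
    rw [eq_top_iff]
    rintro x -
    induction x using DirectSum.Decomposition.inductionOn P.component with
    | zero => exact zero_mem _
    | @homogeneous j x => exact Submodule.subset_span ⟨j, x.2⟩
    | add x y hx hy => exact add_mem hx hy
  obtain ⟨s, hs, hs'⟩ := (Submodule.fg_span_iff_fg_span_finset_subset _).1
    (hspan ▸ Module.Finite.fg_top (R := Aᵐᵒᵖ) (M := P.carrier))
  rw [hspan] at hs'
  choose d hd using fun i : s => hs i.2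
  let π : (s → A) →ₗ[Aᵐᵒᵖ] P.carrier :=
    ∑ i : s, (LinearMap.opSpanSingleton (i : P.carrier)).comp (LinearMap.proj i)
  have hπ : ∀ x, π x = ∑ i : s, op (x i) • (i : P.carrier) := fun x => by
    simp [π, LinearMap.sum_apply]
  have hsurj : Function.Surjective π := by
    rw [← LinearMap.range_eq_top, eq_top_iff, hs', Submodule.span_le]
    intro x hx
    refine ⟨Pi.single ⟨x, hx⟩ 1, ?_⟩
    rw [hπ, Finset.sum_eq_single ⟨x, hx⟩]
    · simp
    · intro i _ hi
      simp [Pi.single_eq_of_ne hi]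
    · simp
  -- Projectivity splits the surjection given by homogeneous generators. The coordinates of the
  -- splitting need not be homogeneous, so they are replaced by their parts of the right degree.
  obtain ⟨g, hg⟩ := Module.projective_lifting_property π LinearMap.id hsurj
  choose f hf using fun i : s => P.exists_homogeneous_part (d i) ((LinearMap.proj i).comp g)
  refine ⟨s, inferInstance, d, fun i => i, f, hd, fun i j x hx => ?_, fun x => ?_⟩
  · rw [hf i j x hx]
    exact SetLike.coe_mem _
  · induction x using DirectSum.Decomposition.inductionOn P.component with
    | zero => simp
    | @homogeneous j x =>
      have h := LinearMap.congr_fun hg (x : P.carrier)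
      rw [LinearMap.comp_apply, hπ, LinearMap.id_apply] at h
      -- Projecting the ungraded identity `h` to degree `j` retains exactly the homogeneous parts of
      -- the functionals.
      let π' : P.carrier →+ P.carrier := ((P.component j).subtype.comp
        (DFinsupp.evalAddMonoidHom j)).comp
          (DirectSum.decomposeAddEquiv P.component).toAddMonoidHom
      have hπ' : ∀ y, π' y = DirectSum.decompose P.component y j := fun _ => rfl
      have h' := congrArg π' h
      rw [map_sum, hπ' x, DirectSum.decompose_of_mem_same _ x.2] at h'
      nth_rewrite 2 [← h']
      refine Finset.sum_congr rfl fun i _ => ?_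
      rw [hπ', P.decompose_op_smul (hd i), hf i j x x.2]
      rfl
    | add x y hx hy =>
      nth_rewrite 2 [← hx]
      nth_rewrite 2 [← hy]
      simp only [map_add, op_add, add_smul, Finset.sum_add_distrib]

end GradedProj

section

universe t

open Quiver LeavittPathAlgebra MulOpposite

/-! ### Frames: dual bases adapted to the vertices -/

namespace GradedProj

variable {K : Type w} [Field K] {V : Type u} [Quiver.{v} V] [Fintype V]
  [∀ a b : V, Fintype (a ⟶ b)]

/-- A dual basis of a graded module, consisting of elements of degree `d`, whose members are
supported at vertices. -/
structure IsFrame (P : GradedProj (grading K V)) (d : ℤ) {ι : Type*} [Fintype ι] (v : ι → V)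
    (m : ι → P.carrier)
    (f : ι → P.carrier →ₗ[(LeavittPathAlgebra K V)ᵐᵒᵖ] LeavittPathAlgebra K V) : Prop where
  mem : ∀ i, m i ∈ P.component d
  apply_mem : ∀ i j, ∀ x ∈ P.component j, f i x ∈ grading K V (j - d)
  smul_vtx : ∀ i, op (vtx K (v i)) • m i = m i
  vtx_mul : ∀ i x, vtx K (v i) * f i x = f i x
  sum_smul : ∀ x, ∑ i, op (f i x) • m i = x

/-- The members of the family are linearly independent over the algebra, in the sense that they form
bases of modules generated by vertices. -/
structure IsDiagonalFrame (P : GradedProj (grading K V)) (d : ℤ) {ι : Type*} [Fintype ι] (v : ι → V)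
    (m : ι → P.carrier)
    (f : ι → P.carrier →ₗ[(LeavittPathAlgebra K V)ᵐᵒᵖ] LeavittPathAlgebra K V) : Prop
    extends IsFrame P d v m f where
  apply_self : ∀ i, f i (m i) = vtx K (v i)
  apply_of_ne : ∀ i j, i ≠ j → f i (m j) = 0

variable {P Q : GradedProj (grading K V)} {d : ℤ} {ι : Type t} {κ : Type*} [Fintype ι] [Fintype κ]
  {v : ι → V} {m : ι → P.carrier}
  {f : ι → P.carrier →ₗ[(LeavittPathAlgebra K V)ᵐᵒᵖ] LeavittPathAlgebra K V}

theorem smul_path_mem {k : ℕ} {a : V} (p : Walk V k a) {x : P.carrier} (hx : x ∈ P.component d) :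
    op (path K p) • x ∈ P.component (d + k) :=
  P.smul_mem hx (path_mem_grading K p)

theorem ghostPath_mul_mem {k : ℕ} {a : V} (p : Walk V k a) {j : ℤ} {x : LeavittPathAlgebra K V}
    (hx : x ∈ grading K V (j - d)) : ghostPath K p * x ∈ grading K V (j - (d + k)) := by
  have h := SetLike.GradedMul.mul_mem (ghostPath_mem_grading K p) hx
  rwa [show -(k : ℤ) + (j - d) = j - (d + k) by ring] at h

theorem sum_smul_path (hV : NoSinks V) (k : ℕ) (a : V) (x : LeavittPathAlgebra K V)
    (y : P.carrier) :
    ∑ p : Walk V k a, op (ghostPath K p * x) • op (path K p) • y = op (vtx K a * x) • y := by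
  simp only [op_smul_op_smul, ← mul_assoc]
  rw [← Finset.sum_smul, ← Finset.op_sum, ← Finset.sum_mul, sum_path_mul_ghostPath hV]

-- Each member of a homogeneous dual basis is expanded along all paths of length `D - d i`, which
-- raises its degree to a common bound `D`; the ends of the paths provide the supporting vertices.
variable (P) in
theorem exists_isFrame (hV : NoSinks V) :
    ∃ (d : ℤ) (ι : Type (max u v w)) (_ : Fintype ι) (v : ι → V) (m : ι → P.carrier)
      (f : ι → P.carrier →ₗ[(LeavittPathAlgebra K V)ᵐᵒᵖ] LeavittPathAlgebra K V),
      IsFrame P d v m f := by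
  obtain ⟨ι, _, d, m, f, hm, hf, hsum⟩ := P.exists_dualBasis
  obtain ⟨D, hD⟩ : ∃ D : ℤ, ∀ i, d i ≤ D := by
    obtain ⟨D, hD⟩ := (Set.finite_range d).bddAbove
    exact ⟨D, fun i => hD (Set.mem_range_self i)⟩
  have hk : ∀ i, d i + ((D - d i).toNat : ℤ) = D := fun i => by
    have := hD i
    omega
  refine ⟨D, Σ i : ι, Σ a : V, Walk V (D - d i).toNat a, inferInstance, fun x => x.2.2.finish,
    fun x => op (path K x.2.2) • m x.1,
    fun x => (LinearMap.mulLeftOp (ghostPath K x.2.2)).comp (f x.1), ?_, ?_, ?_, ?_, ?_⟩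
  · rintro ⟨i, a, p⟩
    have h := smul_path_mem p (hm i)
    rwa [hk] at h
  · rintro ⟨i, a, p⟩ j x hx
    have h := ghostPath_mul_mem p (hf i j x hx)
    rwa [hk] at h
  · rintro ⟨i, a, p⟩
    rw [op_smul_op_smul, path_mul_vtx]
  · rintro ⟨i, a, p⟩ x
    rw [LinearMap.comp_apply, LinearMap.mulLeftOp_apply, ← mul_assoc, vtx_mul_ghostPath]
  · intro x
    simp only [Fintype.sum_sigma, LinearMap.comp_apply, LinearMap.mulLeftOp_apply]
    simp only [sum_smul_path hV]
    simp only [← Finset.sum_smul, ← Finset.op_sum, ← Finset.sum_mul, sum_vtx, one_mul]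
    exact hsum x

/-- The refinement of a frame along all paths of length `k`. -/
theorem IsFrame.refine (hV : NoSinks V) (h : IsFrame P d v m f) (k : ℕ) :
    IsFrame P (d + k) (ι := Σ i, Walk V k (v i)) (fun x => x.2.finish)
      (fun x => op (path K x.2) • m x.1)
      (fun x => (LinearMap.mulLeftOp (ghostPath K x.2)).comp (f x.1)) where
  mem x := smul_path_mem x.2 (h.mem x.1)
  apply_mem x j y hy := ghostPath_mul_mem x.2 (h.apply_mem x.1 j y hy)
  smul_vtx x := by rw [op_smul_op_smul, path_mul_vtx]
  vtx_mul x y := by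
    rw [LinearMap.comp_apply, LinearMap.mulLeftOp_apply, ← mul_assoc, vtx_mul_ghostPath]
  sum_smul x := by
    simp only [Fintype.sum_sigma, LinearMap.comp_apply, LinearMap.mulLeftOp_apply]
    simp only [sum_smul_path hV, h.vtx_mul]
    exact h.sum_smul x

theorem IsDiagonalFrame.refine (hV : NoSinks V) (h : IsDiagonalFrame P d v m f) (k : ℕ) :
    IsDiagonalFrame P (d + k) (ι := Σ i, Walk V k (v i)) (fun x => x.2.finish)
      (fun x => op (path K x.2) • m x.1)
      (fun x => (LinearMap.mulLeftOp (ghostPath K x.2)).comp (f x.1)) where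
  toIsFrame := h.toIsFrame.refine hV k
  apply_self x := by
    rw [LinearMap.comp_apply, LinearMap.mulLeftOp_apply, map_op_smul, h.apply_self, vtx_mul_path,
      ghostPath_mul_path_self]
  apply_of_ne := by
    rintro ⟨i, p⟩ ⟨j, q⟩ hij
    rw [LinearMap.comp_apply, LinearMap.mulLeftOp_apply, map_op_smul]
    by_cases hi : i = j
    · subst hi
      rw [h.apply_self, vtx_mul_path]
      refine ghostPath_mul_path_of_ne fun hpq => hij ?_
      exact Sigma.ext rfl (heq_of_eq hpq)
    · rw [h.apply_of_ne i j hi, zero_mul, mul_zero]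

/-- After refinement, the transition matrix between two frames has scalar entries. -/
theorem IsFrame.exists_scalar (hV : NoSinks V) (h : IsFrame P d v m f) {v' : κ → V}
    {m' : κ → P.carrier}
    {f' : κ → P.carrier →ₗ[(LeavittPathAlgebra K V)ᵐᵒᵖ] LeavittPathAlgebra K V}
    (h' : IsFrame P d v' m' f') :
    ∃ k₀ : ℕ, ∀ k, k₀ ≤ k → ∀ (x : Σ i, Walk V k (v i)) (y : Σ j, Walk V k (v' j)), ∃ c : K,
      (LinearMap.mulLeftOp (ghostPath K x.2)).comp (f x.1) (op (path K y.2) • m' y.1) =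
        c • vtx K x.2.finish := by
  have hmem : ∀ i j, f i (m' j) ∈ grading K V 0 := fun i j => by
    have := h.apply_mem i d (m' j) (h'.mem j)
    rwa [sub_self] at this
  choose k₀ hk₀ using fun x : ι × κ => exists_ghostPath_mul_mul_path hV (hmem x.1 x.2)
  refine ⟨∑ x, k₀ x, ?_⟩
  rintro k hk ⟨i, p⟩ ⟨j, q⟩
  have hle : k₀ (i, j) ≤ ∑ x, k₀ x :=
    Finset.single_le_sum (fun _ _ => Nat.zero_le _) (Finset.mem_univ _)
  obtain ⟨c, hc⟩ := hk₀ (i, j) k (hle.trans hk) _ _ p q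
  refine ⟨c, ?_⟩
  rw [LinearMap.comp_apply, LinearMap.mulLeftOp_apply, map_op_smul, ← mul_assoc, hc]

/-- The vector space structure of a graded module over the Leavitt path algebra. -/
noncomputable abbrev scalarModule (P : GradedProj (grading K V)) : Module K P.carrier :=
  Module.compHom P.carrier (algebraMap K (LeavittPathAlgebra K V)ᵐᵒᵖ)

theorem scalarModule_isScalarTower (P : GradedProj (grading K V)) :
    letI := P.scalarModule
    IsScalarTower K (LeavittPathAlgebra K V)ᵐᵒᵖ P.carrier := by
  let := P.scalarModule
  refine ⟨fun c a x => ?_⟩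
  rw [Algebra.smul_def, mul_smul]
  rfl

/-- A frame whose transition matrix has scalar entries contains a diagonal frame. -/
theorem IsFrame.exists_isDiagonalFrame (h : IsFrame P d v m f)
    (hc : ∀ i j, ∃ c : K, f i (m j) = c • vtx K (v i)) :
    ∃ (κ : Type t) (_ : Fintype κ) (v' : κ → V) (m' : κ → P.carrier)
      (f' : κ → P.carrier →ₗ[(LeavittPathAlgebra K V)ᵐᵒᵖ] LeavittPathAlgebra K V),
      IsDiagonalFrame P d v' m' f' := by
  classical
  let := P.scalarModule
  have := P.scalarModule_isScalarTower
  choose c hc using hc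
  -- A `K`-basis of the span of the frame is selected among its members, and the functionals are
  -- recombined with the coordinates `t` of the discarded ones.
  obtain ⟨κ, s, hs, hspan, hli⟩ := exists_linearIndependent' K m
  have := Fintype.ofInjective s hs
  have ht : ∀ i, ∃ t : κ → K, ∑ k, t k • m (s k) = m i := fun i => by
    rw [← Submodule.mem_span_range_iff_exists_fun, ← Function.comp_def m s, hspan]
    exact Submodule.subset_span (Set.mem_range_self i)
  choose t ht using ht
  let g : κ → P.carrier →ₗ[(LeavittPathAlgebra K V)ᵐᵒᵖ] LeavittPathAlgebra K V := fun k =>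
    ∑ i, (LinearMap.mulLeftOp (t i k • vtx K (v (s k)))).comp (f i)
  have hg : ∀ k x, g k x = ∑ i, t i k • (vtx K (v (s k)) * f i x) := fun k x => by
    simp only [g, LinearMap.sum_apply, LinearMap.comp_apply, LinearMap.mulLeftOp_apply,
      smul_mul_assoc]
  have hframe : IsFrame P d (v ∘ s) (m ∘ s) g := by
    refine ⟨fun k => h.mem _, fun k j x hx => ?_, fun k => h.smul_vtx _, fun k x => ?_,
      fun x => ?_⟩
    · rw [hg]
      refine Submodule.sum_mem _ fun i _ => Submodule.smul_mem _ _ ?_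
      have := SetLike.GradedMul.mul_mem (vtx_mem_grading K V (v (s k))) (h.apply_mem i j x hx)
      rwa [zero_add] at this
    · rw [hg, Finset.mul_sum]
      refine Finset.sum_congr rfl fun i _ => ?_
      rw [mul_smul_comm, ← mul_assoc, Function.comp_apply, vtx_mul_self]
    · nth_rewrite 2 [← h.sum_smul x]
      simp only [hg, op_sum_smul]
      rw [Finset.sum_comm]
      refine Finset.sum_congr rfl fun i _ => ?_
      rw [← ht i, Finset.smul_sum]
      refine Finset.sum_congr rfl fun k _ => ?_
      rw [op_smul, smul_assoc, Function.comp_apply, ← op_smul_op_smul, h.smul_vtx, smul_comm]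
  have he : ∀ k l, ∃ e : K, g k (m (s l)) = e • vtx K (v (s k)) := by
    intro k l
    have : ∀ i, ∃ e : K, t i k • (vtx K (v (s k)) * f i (m (s l))) = e • vtx K (v (s k)) := by
      intro i
      rw [hc, mul_smul_comm, smul_smul]
      by_cases hi : v (s k) = v i
      · exact ⟨_, by rw [hi, vtx_mul_self]⟩
      · exact ⟨0, by rw [vtx_mul_of_ne hi, smul_zero, zero_smul]⟩
    choose e he using this
    exact ⟨∑ i, e i, by rw [hg, Finset.sum_smul, Finset.sum_congr rfl fun i _ => he i]⟩
  choose e he using he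
  -- Expanding `m (s l)` in the new frame gives a `K`-linear relation among independent members, so
  -- the transition matrix is the identity.
  have hδ : ∀ k l, e k l = if k = l then 1 else 0 := by
    intro k l
    have h1 : ∑ k, e k l • m (s k) = ∑ k, (if k = l then (1 : K) else 0) • m (s k) := by
      simp only [ite_smul, one_smul, zero_smul, Finset.sum_ite_eq', Finset.mem_univ, if_true]
      have h2 := hframe.sum_smul (m (s l))
      refine Eq.trans (Finset.sum_congr rfl fun k _ => ?_) h2
      rw [he, op_smul, smul_assoc, Function.comp_apply, h.smul_vtx]
    rw [← sub_eq_zero, ← Finset.sum_sub_distrib] at h1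
    simp only [← sub_smul] at h1
    exact sub_eq_zero.1 (Fintype.linearIndependent_iff.1 hli _ h1 k)
  refine ⟨κ, inferInstance, v ∘ s, m ∘ s, g, hframe, fun k => ?_, fun k l hkl => ?_⟩
  · rw [Function.comp_apply, he, hδ, if_pos rfl, one_smul, Function.comp_apply]
  · rw [Function.comp_apply, he, hδ, if_neg hkl, zero_smul]

/-- Applying `f i` to a relation leaves `c i` times a vertex, which vanishes only if `c i = 0`. -/
theorem IsDiagonalFrame.linearIndependent (hV : NoSinks V) (h : IsDiagonalFrame P d v m f) :
    letI := P.scalarModule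
    LinearIndependent K m := by
  let := P.scalarModule
  have := P.scalarModule_isScalarTower
  rw [Fintype.linearIndependent_iff]
  intro c hc i
  have h1 := congrArg (f i) hc
  rw [map_sum, map_zero, Finset.sum_eq_single i, LinearMap.map_smul_of_tower, h.apply_self] at h1
  · exact smul_vtx_eq_zero hV h1
  · intro j _ hj
    rw [LinearMap.map_smul_of_tower, h.apply_of_ne i j (Ne.symm hj), smul_zero]
  · simp

/-- The number of members of a family of vertices equal to a given vertex. -/
def vtxCount [DecidableEq V] (v : ι → V) (a : V) : ℕ := ∑ i, if v i = a then 1 else 0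

omit [Quiver.{v} V] [Fintype V] [∀ a b : V, Fintype (a ⟶ b)] in
theorem vtxCount_eq_card [DecidableEq V] (v : ι → V) (a : V) :
    vtxCount v a = Fintype.card {i // v i = a} := by
  rw [vtxCount, Fintype.card_subtype, Finset.card_filter]

omit [Quiver.{v} V] [∀ a b : V, Fintype (a ⟶ b)] in
theorem vtxCount_fst [DecidableEq V] (a : V → ℕ) :
    vtxCount (Sigma.fst : (Σ u, Fin (a u)) → V) = a := by
  ext u
  rw [vtxCount, Fintype.sum_sigma, Finset.sum_eq_single u]
  · simp
  · intro x _ hx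
    simp [hx]
  · simp

/-- If the transition matrix between diagonal frames has scalar entries, then the frames have the
same number of members at each vertex. -/
theorem IsDiagonalFrame.vtxCount_le [DecidableEq V] (hV : NoSinks V) (h : IsDiagonalFrame P d v m f)
    {v' : κ → V} {m' : κ → P.carrier}
    {f' : κ → P.carrier →ₗ[(LeavittPathAlgebra K V)ᵐᵒᵖ] LeavittPathAlgebra K V}
    (h' : IsDiagonalFrame P d v' m' f')
    (hc : ∀ j i, ∃ c : K, f' j (m i) = c • vtx K (v' j)) (a : V) :
    vtxCount v a ≤ vtxCount v' a := by
  let := P.scalarModule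
  have := P.scalarModule_isScalarTower
  choose c hc using hc
  have hli := (h.linearIndependent hV).comp (Subtype.val : {i // v i = a} → ι)
    Subtype.val_injective
  have hli' := (h'.linearIndependent hV).comp (Subtype.val : {i // v' i = a} → κ)
    Subtype.val_injective
  rw [vtxCount_eq_card, vtxCount_eq_card, ← finrank_span_eq_card hli, ← finrank_span_eq_card hli']
  have : FiniteDimensional K
      (Submodule.span K (Set.range (m' ∘ (Subtype.val : {i // v' i = a} → κ)))) :=
    FiniteDimensional.span_of_finite K (Set.finite_range _)
  refine Submodule.finrank_mono (Submodule.span_le.2 ?_)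
  rintro _ ⟨⟨i, rfl⟩, rfl⟩
  rw [SetLike.mem_coe, Function.comp_apply, ← h'.sum_smul (m i)]
  refine Submodule.sum_mem _ fun j _ => ?_
  -- Only members of the second frame at the vertex of `m i` contribute, by orthogonality of
  -- distinct vertices; hence spans, and so dimensions, compare vertex by vertex.
  by_cases hj : v' j = v i
  · rw [hc, op_smul, smul_assoc, h'.smul_vtx]
    exact Submodule.smul_mem _ _ (Submodule.subset_span ⟨⟨j, hj⟩, rfl⟩)
  · have h0 : f' j (m i) = 0 := by
      rw [← h.smul_vtx, map_op_smul, hc, smul_mul_assoc, vtx_mul_of_ne hj, smul_zero]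
    rw [h0, op_zero, zero_smul]
    exact zero_mem _

theorem IsDiagonalFrame.reindex (h : IsDiagonalFrame P d v m f) (e : κ ≃ ι) :
    IsDiagonalFrame P d (v ∘ e) (m ∘ e) (f ∘ e) where
  mem _ := h.mem _
  apply_mem _ := h.apply_mem _
  smul_vtx _ := h.smul_vtx _
  vtx_mul _ := h.vtx_mul _
  sum_smul x := (e.sum_comp fun i => op (f i x) • m i).trans (h.sum_smul x)
  apply_self _ := h.apply_self _
  apply_of_ne _ _ hij := h.apply_of_ne _ _ fun he => hij (e.injective he)

/-! ### The vector in `ℕ^V` of a graded projective module -/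

/-- There is a diagonal frame of degree `d` with `a u` members at the vertex `u`. -/
def HasFrame (P : GradedProj (grading K V)) (d : ℤ) (a : V → ℕ) : Prop :=
  ∃ (m : (Σ u, Fin (a u)) → P.carrier)
    (f : (Σ u, Fin (a u)) → P.carrier →ₗ[(LeavittPathAlgebra K V)ᵐᵒᵖ] LeavittPathAlgebra K V),
    IsDiagonalFrame P d Sigma.fst m f

theorem IsDiagonalFrame.hasFrame [DecidableEq V] (h : IsDiagonalFrame P d v m f) :
    HasFrame P d (vtxCount v) := by
  let e : (Σ u, Fin (vtxCount v u)) ≃ ι :=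
    (Equiv.sigmaCongrRight fun u =>
      (finCongr (vtxCount_eq_card v u)).trans (Fintype.equivFin {i // v i = u}).symm).trans
      (Equiv.sigmaFiberEquiv v)
  have he : v ∘ e = Sigma.fst := funext fun x =>
    ((Fintype.equivFin {i // v i = x.1}).symm (finCongr (vtxCount_eq_card v x.1) x.2)).2
  have := h.reindex e
  rw [he] at this
  exact ⟨_, _, this⟩

theorem IsDiagonalFrame.congr_iso (h : IsDiagonalFrame P d v m f)
    (e : P.carrier ≃ₗ[(LeavittPathAlgebra K V)ᵐᵒᵖ] Q.carrier)
    (he : ∀ i x, x ∈ P.component i ↔ e x ∈ Q.component i) :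
    IsDiagonalFrame Q d v (fun i => e (m i)) (fun i => (f i).comp e.symm.toLinearMap) where
  mem i := (he _ _).1 (h.mem i)
  apply_mem i j x hx := h.apply_mem i j _ ((he _ _).2 (by rwa [LinearEquiv.coe_coe,
    e.apply_symm_apply]))
  smul_vtx i := by rw [← map_smul, h.smul_vtx]
  vtx_mul i x := h.vtx_mul i _
  sum_smul x := by
    simp only [← map_smul, ← map_sum, LinearMap.comp_apply, LinearEquiv.coe_coe]
    rw [h.sum_smul, e.apply_symm_apply]
  apply_self i := by
    rw [LinearMap.comp_apply, LinearEquiv.coe_coe, e.symm_apply_apply, h.apply_self]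
  apply_of_ne i j hij := by
    rw [LinearMap.comp_apply, LinearEquiv.coe_coe, e.symm_apply_apply, h.apply_of_ne i j hij]

theorem IsDiagonalFrame.apply_sum (h : IsDiagonalFrame P d v m f) (i : ι)
    (g : ι → LeavittPathAlgebra K V) :
    f i (∑ j, op (g j) • m j) = vtx K (v i) * g i := by
  rw [map_sum, Finset.sum_eq_single i]
  · rw [map_op_smul, h.apply_self]
  · intro j _ hj
    rw [map_op_smul, h.apply_of_ne i j (Ne.symm hj), zero_mul]
  · simp

/-- The homomorphism which maps one frame to another. -/
noncomputable def frameHom (f : ι → P.carrier →ₗ[(LeavittPathAlgebra K V)ᵐᵒᵖ] LeavittPathAlgebra K V)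
    (m' : ι → Q.carrier) : P.carrier →ₗ[(LeavittPathAlgebra K V)ᵐᵒᵖ] Q.carrier :=
  ∑ i, (LinearMap.opSpanSingleton (m' i)).comp (f i)

theorem frameHom_apply
    (f : ι → P.carrier →ₗ[(LeavittPathAlgebra K V)ᵐᵒᵖ] LeavittPathAlgebra K V)
    (m' : ι → Q.carrier) (x : P.carrier) : frameHom f m' x = ∑ i, op (f i x) • m' i := by
  simp [frameHom, LinearMap.sum_apply]

theorem IsDiagonalFrame.frameHom_frameHom (h : IsDiagonalFrame P d v m f) {m' : ι → Q.carrier}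
    {f' : ι → Q.carrier →ₗ[(LeavittPathAlgebra K V)ᵐᵒᵖ] LeavittPathAlgebra K V}
    (h' : IsDiagonalFrame Q d v m' f') (x : P.carrier) :
    frameHom f' m (frameHom f m' x) = x := by
  rw [frameHom_apply, frameHom_apply]
  simp only [h'.apply_sum, h.vtx_mul]
  exact h.sum_smul x

theorem IsDiagonalFrame.frameHom_mem (h : IsDiagonalFrame P d v m f) {m' : ι → Q.carrier}
    {f' : ι → Q.carrier →ₗ[(LeavittPathAlgebra K V)ᵐᵒᵖ] LeavittPathAlgebra K V}
    (h' : IsDiagonalFrame Q d v m' f') {j : ℤ} {x : P.carrier} (hx : x ∈ P.component j) :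
    frameHom f m' x ∈ Q.component j := by
  rw [frameHom_apply]
  refine sum_mem fun i _ => ?_
  have := Q.smul_mem (h'.mem i) (h.apply_mem i j x hx)
  rwa [add_sub_cancel] at this

namespace HasFrame

variable {a b : V → ℕ}

/-- Diagonal frames with the same vertices and degree have the same orthogonality relations, so
matching their members gives mutually inverse graded maps. -/
theorem iso (hP : HasFrame P d a) (hQ : HasFrame Q d a) : P.Iso Q := by
  obtain ⟨m, f, h⟩ := hP
  obtain ⟨m', f', h'⟩ := hQ
  refine ⟨LinearEquiv.ofLinearMap (frameHom f m') (frameHom f' m)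
    (LinearMap.ext fun x => h'.frameHom_frameHom h x)
    (LinearMap.ext fun x => h.frameHom_frameHom h' x), fun i x => ⟨fun hx => ?_, fun hx => ?_⟩⟩
  · exact h.frameHom_mem h' hx
  · rw [← h.frameHom_frameHom h' x]
    exact h'.frameHom_mem h hx

theorem of_iso (hP : HasFrame P d a) (hPQ : P.Iso Q) : HasFrame Q d a := by
  obtain ⟨m, f, h⟩ := hP
  obtain ⟨e, he⟩ := hPQ
  exact ⟨_, _, h.congr_iso e he⟩

-- Comparing a frame with itself, its transition matrix becomes scalar after refinement, and a
-- diagonal frame can then be extracted.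
variable (P) in
theorem _root_.GradedProj.exists_hasFrame [DecidableEq V] (hV : NoSinks V) :
    ∃ (d : ℤ) (a : V → ℕ), HasFrame P d a := by
  obtain ⟨d, ι, _, v, m, f, h⟩ := P.exists_isFrame hV
  obtain ⟨k, hk⟩ := h.exists_scalar hV h
  obtain ⟨κ, _, v', m', f', h'⟩ := (h.refine hV k).exists_isDiagonalFrame fun x y =>
    hk k le_rfl x y
  exact ⟨_, _, h'.hasFrame⟩

theorem vtxCount_finish [DecidableEq V] (a : V → ℕ) (k : ℕ) :
    vtxCount (fun x : Σ i : (Σ u, Fin (a u)), Walk V k i.1 => x.2.finish) =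
      Matrix.vecMul a (adjacency V ^ k) := by
  ext c
  rw [vtxCount, Fintype.sum_sigma]
  simp only [Walk.card_finish_eq]
  rw [Fintype.sum_sigma]
  simp [Matrix.vecMul, dotProduct]

theorem refine [DecidableEq V] (hV : NoSinks V) (h : HasFrame P d a) (k : ℕ) :
    HasFrame P (d + k) (Matrix.vecMul a (adjacency V ^ k)) := by
  obtain ⟨m, f, h⟩ := h
  rw [← vtxCount_finish]
  exact (h.refine hV k).hasFrame

/-- Refine both frames until the transition matrices in both directions are scalar; the vertex
counts then bound each other. -/
theorem exists_vecMul_eq [DecidableEq V] (hV : NoSinks V) (ha : HasFrame P d a)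
    (hb : HasFrame P d b) :
    ∃ k : ℕ, Matrix.vecMul a (adjacency V ^ k) = Matrix.vecMul b (adjacency V ^ k) := by
  obtain ⟨m, f, h⟩ := ha
  obtain ⟨m', f', h'⟩ := hb
  obtain ⟨k, hk⟩ := h.exists_scalar hV h'.toIsFrame
  obtain ⟨k', hk'⟩ := h'.exists_scalar hV h.toIsFrame
  refine ⟨k + k', ?_⟩
  rw [← vtxCount_finish, ← vtxCount_finish]
  exact funext fun u => le_antisymm
    ((h.refine hV _).vtxCount_le hV (h'.refine hV _) (hk' _ (Nat.le_add_left _ _)) u)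
    ((h'.refine hV _).vtxCount_le hV (h.refine hV _) (hk _ (Nat.le_add_right _ _)) u)

variable (K V d) in
protected theorem zero : HasFrame (GradedProj.zero (grading K V)) d 0 :=
  ⟨0, 0, ⟨fun _ => trivial, fun x => x.2.elim0, fun _ => rfl, fun x => x.2.elim0, fun _ => rfl⟩,
    fun x => x.2.elim0, fun x => x.2.elim0⟩

theorem add [DecidableEq V] (hP : HasFrame P d a) (hQ : HasFrame Q d b) :
    HasFrame (P.add Q) d (a + b) := by
  obtain ⟨m, f, h⟩ := hP
  obtain ⟨m', f', h'⟩ := hQ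
  have hcount : vtxCount (Sum.elim Sigma.fst Sigma.fst : (Σ u, Fin (a u)) ⊕ (Σ u, Fin (b u)) → V) =
      a + b := by
    ext u
    rw [vtxCount, Fintype.sum_sum_type]
    exact congrArg₂ (· + ·) (congrFun (vtxCount_fst a) u) (congrFun (vtxCount_fst b) u)
  have hframe : IsDiagonalFrame (P.add Q) d
      (Sum.elim Sigma.fst Sigma.fst : (Σ u, Fin (a u)) ⊕ (Σ u, Fin (b u)) → V)
      (Sum.elim (fun i => (m i, 0)) fun i => (0, m' i))
      (Sum.elim (fun i => (f i).comp (LinearMap.fst _ P.carrier Q.carrier))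
        fun i => (f' i).comp (LinearMap.snd _ P.carrier Q.carrier)) := by
    refine ⟨⟨?_, ?_, ?_, ?_, ?_⟩, ?_, ?_⟩
    · rintro (i | i)
      · exact ⟨h.mem i, zero_mem _⟩
      · exact ⟨zero_mem _, h'.mem i⟩
    · rintro (i | i) j x hx
      · exact h.apply_mem i j _ hx.1
      · exact h'.apply_mem i j _ hx.2
    · rintro (i | i)
      · exact Prod.ext (h.smul_vtx i) (smul_zero _)
      · exact Prod.ext (smul_zero _) (h'.smul_vtx i)
    · rintro (i | i) x
      · exact h.vtx_mul i _
      · exact h'.vtx_mul i _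
    · rintro ⟨x, y⟩
      rw [Fintype.sum_sum_type]
      change ∑ i, op (f i x) • ((m i, 0) : P.carrier × Q.carrier) +
        ∑ i, op (f' i y) • ((0, m' i) : P.carrier × Q.carrier) = (x, y)
      simp only [Prod.smul_mk, smul_zero]
      rw [Prod.ext_iff, Prod.fst_add, Prod.snd_add, Prod.fst_sum, Prod.fst_sum, Prod.snd_sum,
        Prod.snd_sum]
      simp [h.sum_smul, h'.sum_smul]
    · rintro (i | i)
      · exact h.apply_self i
      · exact h'.apply_self i
    · rintro (i | i) (j | j) hij
      · exact h.apply_of_ne i j fun he => hij (congrArg _ he)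
      · exact map_zero (f i)
      · exact map_zero (f' i)
      · exact h'.apply_of_ne i j fun he => hij (congrArg _ he)
  rw [← hcount]
  exact hframe.hasFrame

theorem shift (h : HasFrame P d a) (n : ℤ) : HasFrame (P.shift n) (d - n) a := by
  obtain ⟨m, f, h⟩ := h
  refine ⟨m, f, ⟨fun i => ?_, fun i j x hx => ?_, h.smul_vtx, h.vtx_mul, h.sum_smul⟩, h.apply_self,
    h.apply_of_ne⟩
  · change m i ∈ P.component (d - n + n)
    rw [sub_add_cancel]
    exact h.mem i
  · have := h.apply_mem i (j + n) x hx
    rwa [show j + n - d = j - (d - n) by ring] at this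

end HasFrame

end GradedProj

end

section

open Quiver LeavittPathAlgebra MulOpposite

/-! ### The graded Grothendieck group of a Leavitt path algebra -/

section

variable {K : Type w} [Field K] {V : Type u} [Quiver.{v} V] [Fintype V]
  [∀ a b : V, Fintype (a ⟶ b)]

variable (K) in
theorem LeavittPathAlgebra.mem_range_mulLeftOp_vtx {a : V} {x : LeavittPathAlgebra K V} :
    x ∈ LinearMap.range (LinearMap.mulLeftOp (vtx K a)) ↔ vtx K a * x = x := by
  constructor
  · rintro ⟨y, rfl⟩
    rw [LinearMap.mulLeftOp_apply, ← mul_assoc, vtx_mul_self]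
  · exact fun h => ⟨x, h⟩

variable (K) in
/-- The graded projective module generated by a vertex. -/
noncomputable def GradedProj.vertexModule (a : V) : GradedProj (grading K V) where
  carrier := LinearMap.range (LinearMap.mulLeftOp (vtx K a))
  component i := (grading K V i).toAddSubgroup.comap
    (LinearMap.range (LinearMap.mulLeftOp (vtx K a))).subtype.toAddMonoidHom
  isInternal := by
    set M := LinearMap.range (LinearMap.mulLeftOp (vtx K a))
    set D : ℤ → AddSubgroup M := fun i =>
      (grading K V i).toAddSubgroup.comap M.subtype.toAddMonoidHom
    constructor
    -- Independence of the components is inherited from the grading of the algebra.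
    · let ι : (⨁ i, D i) →+ ⨁ i, grading K V i := DirectSum.map fun i =>
        { toFun := fun x => ⟨x.1.1, x.2⟩, map_zero' := rfl, map_add' := fun _ _ => rfl }
      have h : ∀ x, DirectSum.coeAddMonoidHom (grading K V) (ι x) =
          (DirectSum.coeAddMonoidHom D x : M) := by
        intro x
        induction x using DirectSum.induction_on with
        | zero => simp
        | of i x =>
          rw [DirectSum.map_of, DirectSum.coeAddMonoidHom_of, DirectSum.coeAddMonoidHom_of]
          rfl
        | add x y hx hy => rw [map_add, map_add, hx, hy, map_add, Submodule.coe_add]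
      rw [injective_iff_map_eq_zero]
      intro x hx
      have h1 := h x
      rw [hx, ZeroMemClass.coe_zero] at h1
      have h2 : ι x = 0 := (DirectSum.Decomposition.isInternal (grading K V)).1
        (h1.trans (map_zero _).symm)
      refine DFinsupp.ext fun i => Subtype.ext (Subtype.ext ?_)
      have h3 : (ι x i : LeavittPathAlgebra K V) = 0 := by rw [h2]; rfl
      rw [DirectSum.map_apply] at h3
      exact h3
    -- Left multiplication by a vertex preserves degree, so it carries a homogeneous decomposition
    -- of `y` into the module.
    · have h : ∀ y : LeavittPathAlgebra K V, ∃ x : ⨁ i, D i,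
          DirectSum.coeAddMonoidHom D x = (LinearMap.mulLeftOp (vtx K a)).rangeRestrict y := by
        intro y
        induction y using DirectSum.Decomposition.inductionOn (grading K V) with
        | zero => exact ⟨0, by simp⟩
        | @homogeneous i y =>
          refine ⟨DirectSum.of (fun i => D i) i ⟨_, ?_⟩, DirectSum.coeAddMonoidHom_of _ _ _⟩
          have := SetLike.GradedMul.mul_mem (vtx_mem_grading K V a) y.2
          rwa [zero_add] at this
        | add y z hy hz =>
          obtain ⟨x, hx⟩ := hy
          obtain ⟨x', hx'⟩ := hz
          exact ⟨x + x', by rw [map_add, hx, hx', map_add]⟩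
      intro y
      obtain ⟨z, rfl⟩ := (LinearMap.mulLeftOp (vtx K a)).surjective_rangeRestrict y
      exact h z
  smul_mem {i j b m} hm hb := by
    change (m : LeavittPathAlgebra K V) * b ∈ grading K V (i + j)
    exact SetLike.GradedMul.mul_mem hm hb
  finite :=
    haveI := Module.Finite.equiv (LinearEquiv.opSelf (A := LeavittPathAlgebra K V)).symm
    inferInstance
  projective := by
    have := Module.Projective.of_equiv (LinearEquiv.opSelf (A := LeavittPathAlgebra K V)).symm
    refine Module.Projective.of_split (LinearMap.range (LinearMap.mulLeftOp (vtx K a))).subtype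
      (LinearMap.mulLeftOp (vtx K a)).rangeRestrict (LinearMap.ext fun x => Subtype.ext ?_)
    exact (mem_range_mulLeftOp_vtx K).1 x.2

variable (K) in
theorem GradedProj.hasFrame_vertexModule [DecidableEq V] (a : V) :
    HasFrame (vertexModule K a) 0 (Pi.single a 1) := by
  have hcount : vtxCount (fun _ : Unit => a) = Pi.single a 1 := by
    ext b
    simp [vtxCount, Pi.single_apply, eq_comm]
  have hframe : IsDiagonalFrame (vertexModule K a) 0 (fun _ : Unit => a)
      (fun _ => ⟨vtx K a, (mem_range_mulLeftOp_vtx K).2 (vtx_mul_self K a)⟩)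
      (fun _ => (LinearMap.range (LinearMap.mulLeftOp (vtx K a))).subtype) := by
    refine ⟨⟨fun _ => vtx_mem_grading K V a, fun _ j x hx => ?_, fun _ => ?_, fun _ x => ?_,
      fun x => ?_⟩, fun _ => rfl, fun i j hij => absurd rfl hij⟩
    · rw [sub_zero]
      exact hx
    · exact Subtype.ext (vtx_mul_self K a)
    · exact (mem_range_mulLeftOp_vtx K).1 x.2
    · rw [Fintype.sum_unique]
      exact Subtype.ext ((mem_range_mulLeftOp_vtx K).1 x.2)
  rw [← hcount]
  exact hframe.hasFrame

/-! ### Vectors of classes in `𝒱^gr` -/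

namespace GradedV

/-- The class of a module with a diagonal frame of degree `d`. -/
def HasFrame (x : GradedV (grading K V)) (d : ℤ) (a : V → ℕ) : Prop :=
  ∃ P, mk P = x ∧ P.HasFrame d a

variable {x y : GradedV (grading K V)} {d : ℤ} {a b : V → ℕ}

theorem HasFrame.eq (hx : HasFrame x d a) (hy : HasFrame y d a) : x = y := by
  obtain ⟨P, rfl, hP⟩ := hx
  obtain ⟨Q, rfl, hQ⟩ := hy
  exact Quotient.sound (hP.iso hQ)

variable [DecidableEq V]

theorem HasFrame.add (hx : HasFrame x d a) (hy : HasFrame y d b) : HasFrame (x + y) d (a + b) := by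
  obtain ⟨P, rfl, hP⟩ := hx
  obtain ⟨Q, rfl, hQ⟩ := hy
  exact ⟨P.add Q, rfl, hP.add hQ⟩

omit [DecidableEq V] in
theorem HasFrame.shift (hx : HasFrame x d a) (n : ℤ) :
    HasFrame (GradedV.shift _ n x) (d - n) a := by
  obtain ⟨P, rfl, hP⟩ := hx
  exact ⟨P.shift n, rfl, hP.shift n⟩

theorem HasFrame.refine (hV : NoSinks V) (hx : HasFrame x d a) (k : ℕ) :
    HasFrame x (d + k) (Matrix.vecMul a (adjacency V ^ k)) := by
  obtain ⟨P, rfl, hP⟩ := hx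
  exact ⟨P, rfl, hP.refine hV k⟩

theorem HasFrame.exists_vecMul_eq (hV : NoSinks V) (ha : HasFrame x d a) (hb : HasFrame x d b) :
    ∃ k : ℕ, Matrix.vecMul a (adjacency V ^ k) = Matrix.vecMul b (adjacency V ^ k) := by
  obtain ⟨P, rfl, hP⟩ := ha
  obtain ⟨Q, hQP, hQ⟩ := hb
  exact hP.exists_vecMul_eq hV (hQ.of_iso (Quotient.exact hQP))

/-- Allowing every sufficiently large degree lets several classes be compared in a common one. -/
theorem exists_hasFrame (hV : NoSinks V) (x : GradedV (grading K V)) :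
    ∃ d₀ : ℤ, ∀ d, d₀ ≤ d → ∃ a, HasFrame x d a := by
  obtain ⟨P, rfl⟩ := Quotient.exists_rep x
  obtain ⟨d₀, a, h⟩ := P.exists_hasFrame hV
  refine ⟨d₀, fun d hd => ?_⟩
  have h' := HasFrame.refine hV ⟨P, rfl, h⟩ (d - d₀).toNat
  rw [show d₀ + ((d - d₀).toNat : ℤ) = d by omega] at h'
  exact ⟨_, h'⟩

/-- In a common degree and after a common refinement, addition is that of vectors in `ℕ^V`, where
cancellation is clear. Hence `𝒱^gr` embeds in its group completion. -/
theorem isCancelAdd (hV : NoSinks V) : IsCancelAdd (GradedV (grading K V)) := by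
  have h : ∀ x y z : GradedV (grading K V), x + y = x + z → y = z := by
    intro x y z hxyz
    obtain ⟨d₁, h₁⟩ := exists_hasFrame hV x
    obtain ⟨d₂, h₂⟩ := exists_hasFrame hV y
    obtain ⟨d₃, h₃⟩ := exists_hasFrame hV z
    obtain ⟨a, ha⟩ := h₁ (max d₁ (max d₂ d₃)) (le_max_left _ _)
    obtain ⟨b, hb⟩ := h₂ (max d₁ (max d₂ d₃)) ((le_max_left _ _).trans (le_max_right _ _))
    obtain ⟨c, hc⟩ := h₃ (max d₁ (max d₂ d₃)) ((le_max_right _ _).trans (le_max_right _ _))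
    obtain ⟨k, hk⟩ := (ha.add hb).exists_vecMul_eq hV (hxyz ▸ ha.add hc)
    rw [Matrix.add_vecMul, Matrix.add_vecMul] at hk
    have hb' := hb.refine hV k
    rw [add_left_cancel hk] at hb'
    exact hb'.eq (hc.refine hV k)
  exact { add_left_cancel := fun x y z => h x y z
          add_right_cancel := fun x y z hxyz =>
            h x y z (by simpa only [add_comm] using hxyz) }

omit [DecidableEq V] in
variable (K) in
theorem hasFrame_zero (d : ℤ) : HasFrame (0 : GradedV (grading K V)) d 0 :=
  ⟨_, rfl, GradedProj.HasFrame.zero K V d⟩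

theorem HasFrame.nsmul (h : HasFrame x d a) (n : ℕ) : HasFrame (n • x) d (n • a) := by
  induction n with
  | zero =>
    rw [zero_smul, zero_smul]
    exact hasFrame_zero K d
  | succ n ih =>
    rw [succ_nsmul, succ_nsmul]
    exact ih.add h

theorem HasFrame.sum {ι : Type*} (s : Finset ι) {x : ι → GradedV (grading K V)} {a : ι → V → ℕ}
    (h : ∀ i, HasFrame (x i) d (a i)) : HasFrame (∑ i ∈ s, x i) d (∑ i ∈ s, a i) := by
  classical
  induction s using Finset.induction_on with
  | empty => exact hasFrame_zero K d
  | insert i s hi ih =>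
    rw [Finset.sum_insert hi, Finset.sum_insert hi]
    exact (h i).add ih

variable (K) in
theorem hasFrame_sum_vertexModule (a : V → ℕ) :
    HasFrame (∑ u, a u • mk (GradedProj.vertexModule K u)) 0 a := by
  have h := HasFrame.sum Finset.univ fun u : V =>
    HasFrame.nsmul ⟨_, rfl, GradedProj.hasFrame_vertexModule K u⟩ (a u)
  have ha : ∑ u, a u • (Pi.single u 1 : V → ℕ) = a := by
    ext u
    simp [Finset.sum_apply, Pi.single_apply]
  rwa [ha] at h

end GradedV

/-! ### Identification of `K₀^gr` with the dimension module -/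

namespace GradedK0

open LaurentPolynomial

variable [DecidableEq V]

omit [DecidableEq V] in
theorem natComb_of (a : V → ℕ) :
    natComb (fun u => of (grading K V) (GradedV.mk (GradedProj.vertexModule K u))) a =
      of (grading K V) (∑ u, a u • GradedV.mk (GradedProj.vertexModule K u)) := by
  rw [map_sum, Fintype.linearCombination_apply]
  exact Finset.sum_congr rfl fun u _ => (map_nsmul _ _ _).symm

omit [DecidableEq V] in
theorem T_smul_of (n : ℤ) (x : GradedV (grading K V)) :
    (T n : ℤ[T;T⁻¹]) • of (grading K V) x = of (grading K V) (GradedV.shift _ n x) := by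
  obtain ⟨P, rfl⟩ := Quotient.exists_rep x
  exact T_smul_of_mk _ n P

omit [DecidableEq V] in
theorem exists_eq_sub (x : GradedK0 (grading K V)) :
    ∃ y z, x = of (grading K V) y - of (grading K V) z := by
  induction x using AddLocalization.ind with | _ x
  refine ⟨x.1, x.2, ?_⟩
  refine Eq.trans ?_ (Algebra.GrothendieckAddGroup.mk_sub_mk x.1 (x.2 : GradedV (grading K V)) 0
    0).symm
  congr 1
  · exact (add_zero _).symm
  · exact Subtype.ext (zero_add _).symm

/-- The graded Grothendieck group of a Leavitt path algebra is the dimension module of the adjacency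
matrix. -/
theorem isDimensionModule (hV : NoSinks V) :
    (adjacency V).IsDimensionModule (positiveCone (grading K V))
      fun u => of (grading K V) (GradedV.mk (GradedProj.vertexModule K u)) where
  intertwines u := by
    rw [T_smul_of, natComb_of]
    -- One refinement replaces the vertex `u` in degree `0` by row `u` of the adjacency matrix in
    -- degree `1`; shifting by `1` returns to degree `0`.
    have h := (GradedV.HasFrame.refine hV ⟨_, rfl, GradedProj.hasFrame_vertexModule K u⟩ 1).shift 1
    rw [zero_add, Nat.cast_one, sub_self, pow_one, Matrix.single_one_vecMul] at h
    exact congrArg _ (h.eq (GradedV.hasFrame_sum_vertexModule K _))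
  mem_cone x := by
    constructor
    · rintro ⟨x, rfl⟩
      obtain ⟨d, hd⟩ := GradedV.exists_hasFrame hV x
      -- The degree is raised to a natural number, as the cone condition asks for a natural
      -- exponent.
      obtain ⟨a, ha⟩ := hd (d.toNat : ℤ) (Int.self_le_toNat d)
      refine ⟨d.toNat, a, ?_⟩
      rw [natComb_of, T_smul_of]
      have h := (GradedV.hasFrame_sum_vertexModule K a).shift (-d.toNat : ℤ)
      rw [zero_sub, neg_neg] at h
      exact congrArg _ (ha.eq h)
    · rintro ⟨n, a, rfl⟩
      rw [natComb_of, T_smul_of]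
      exact ⟨_, rfl⟩
  exists_sub x := by
    obtain ⟨y, z, rfl⟩ := exists_eq_sub x
    exact ⟨_, ⟨y, rfl⟩, _, ⟨z, rfl⟩, rfl⟩
  eq_of_natComb_eq a b hab := by
    -- Cancellation turns equality in the group completion into equality of classes, whose vectors
    -- can then be compared.
    have := GradedV.isCancelAdd (K := K) hV
    rw [natComb_of, natComb_of] at hab
    have h := Algebra.GrothendieckAddGroup.of_injective hab
    exact (GradedV.hasFrame_sum_vertexModule K a).exists_vecMul_eq hV
      (h ▸ GradedV.hasFrame_sum_vertexModule K b)

end GradedK0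

end

end

theorem corollary5p2 {K : Type*} [Field K]
    {V : Type*} [Quiver V] [Fintype V] [DecidableEq V] [∀ a b : V, Fintype (a ⟶ b)]
    {W : Type*} [Quiver W] [Fintype W] [DecidableEq W] [∀ a b : W, Fintype (a ⟶ b)]
    (hV : Quiver.NoSinks V) (hW : Quiver.NoSinks W) :
    Matrix.ShiftEquivalent (Quiver.adjacency V) (Quiver.adjacency W) ↔
      ∃ φ : GradedK0 (LeavittPathAlgebra.grading K V) ≃ₗ[ℤ[T;T⁻¹]]
          GradedK0 (LeavittPathAlgebra.grading K W),
        ∀ x y, x ≤ y ↔ φ x ≤ φ y := by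
  rw [(GradedK0.isDimensionModule (K := K) hV).shiftEquivalent_iff
    (GradedK0.isDimensionModule (K := K) hW)]
  -- Since `φ` is additive, matching the orders amounts to matching the cones: use the difference `y
  -- - x` one way and comparison with `0` the other.
  refine exists_congr fun φ => ⟨fun h x y => ?_, fun h x => ?_⟩
  · rw [GradedK0.le_iff, GradedK0.le_iff, h, map_sub]
  · simpa only [GradedK0.le_iff, map_zero, sub_zero] using h 0 x
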